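/- For $n\in\mathbb{N}$ let $\mathcal{S}_n(123)$ be the set of permutations $\sigma=\sigma_1\sigma_2\cdots\sigma_n$ of $\{1,2,\dots,n\}$ that avoid the pattern $123$, that is, for which there are no indices $i<j<k$ with $\sigma_i<\sigma_j<\sigma_k$, and let $\mathrm{fp}(\sigma)$ denote the number of fixed points of $\sigma$. For $q>0$ let $\mathbb{P}_n^{q,123}$ be the probability measure on $\mathcal{S}_n(123)$ given by $$\mathbb{P}_n^{q,123}(S)=\frac{\sum_{\sigma\in S}q^{\mathrm{fp}(\sigma)}}{\sum_{\sigma\in\mathcal{S}_n(123)}q^{\mathrm{fp}(\sigma)}},\qquad S\subset\mathcal{S}_n(123).$$ **Theorem.** Let $q>0$ and let $A$ and $B$ be independent Bernoulli$\left(\frac{q}{3+q}\right)$ random variables. If $\Pi_n$ is a random permutation distributed according to $\mathbb{P}_n^{q,123}$, then $\mathrm{fp}(\Pi_n)$ converges in distribution to $A+B$ as $n\to\infty$. -/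

import Mathlib

open MeasureTheory ProbabilityTheory Filter

/-- The number of fixed points of a permutation of `n` letters. -/
def fp {n : ℕ} (σ : Equiv.Perm (Fin n)) : ℕ :=
  (Finset.univ.filter fun i => σ i = i).card

/-- `σ` contains the pattern `τ`: some subsequence of the one-line notation of `σ` is in the
same relative order as `τ`. -/
def ContainsPattern {m n : ℕ} (τ : Equiv.Perm (Fin m)) (σ : Equiv.Perm (Fin n)) : Prop :=
  ∃ i : Fin m → Fin n, StrictMono i ∧ ∀ j k : Fin m, σ (i j) < σ (i k) ↔ τ j < τ k

/-- The set of permutations of `n` letters that avoid the pattern `τ`. -/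
def Avoiding (n : ℕ) {m : ℕ} (τ : Equiv.Perm (Fin m)) : Type :=
  {σ : Equiv.Perm (Fin n) // ¬ ContainsPattern τ σ}

noncomputable instance Avoiding.instFintype (n : ℕ) {m : ℕ} (τ : Equiv.Perm (Fin m)) : Fintype (Avoiding n τ) :=
  Fintype.ofInjective (fun σ : Avoiding n τ => σ.1) Subtype.val_injective

/-- Every set of pattern-avoiding permutations is an event. -/
instance Avoiding.instMeasurableSpace (n : ℕ) {m : ℕ} (τ : Equiv.Perm (Fin m)) : MeasurableSpace (Avoiding n τ) := ⊤

/-- The pattern 123 (one-line notation of the identity of three letters). -/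
def pattern123 : Equiv.Perm (Fin 3) := 1

/-- The decreasing permutation avoids 123. -/
instance Avoiding.instNonempty123 (n : ℕ) : Nonempty (Avoiding n pattern123) := by
  refine ⟨⟨Fin.revPerm, ?_⟩⟩
  rintro ⟨i, hi, h⟩
  have h1 : Fin.revPerm (i 0) < Fin.revPerm (i 1) := (h 0 1).2 (by simp [pattern123])
  have h2 : i 0 < i 1 := hi (by simp)
  simp only [Fin.revPerm_apply, Fin.rev_lt_rev] at h1
  exact absurd h1 h2.not_gt

/-- The normalization constant: the sum of `q ^ fp σ` over the `τ`-avoiding permutations. -/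
noncomputable def normConst (q : ℝ) (n : ℕ) {m : ℕ} (τ : Equiv.Perm (Fin m)) : ℝ :=
  ∑ σ : Avoiding n τ, q ^ fp σ.1

/-- The fixed point biased measure on `τ`-avoiding permutations, in which each `σ` has mass
`q ^ fp σ` divided by the normalization constant. -/
noncomputable def biasedMeasure (q : ℝ) (n : ℕ) {m : ℕ} (τ : Equiv.Perm (Fin m)) :
    Measure (Avoiding n τ) :=
  ∑ σ : Avoiding n τ, ENNReal.ofReal (q ^ fp σ.1 / normConst q n τ) • Measure.dirac σ

theorem isProbabilityMeasure_biasedMeasure {q : ℝ} (hq : 0 < q) (n : ℕ) {m : ℕ}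
    (τ : Equiv.Perm (Fin m)) [Nonempty (Avoiding n τ)] :
    IsProbabilityMeasure (biasedMeasure q n τ) := by
  have hZ : 0 < normConst q n τ :=
    Finset.sum_pos (fun σ _ => pow_pos hq _) Finset.univ_nonempty
  constructor
  simp only [biasedMeasure, Measure.coe_finsetSum, Finset.sum_apply, Measure.smul_apply,
    measure_univ, smul_eq_mul, mul_one]
  rw [← ENNReal.ofReal_sum_of_nonneg fun σ _ => div_nonneg (pow_pos hq _).le hZ.le,
    ← Finset.sum_div]
  change ENNReal.ofReal (normConst q n τ / normConst q n τ) = 1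
  rw [div_self hZ.ne', ENNReal.ofReal_one]

/-- The fixed point biased measure with bias parameter `q > 0`, as a probability measure. -/
noncomputable def biasedProb (q : ℝ) (hq : 0 < q) (n : ℕ) {m : ℕ} (τ : Equiv.Perm (Fin m))
    [Nonempty (Avoiding n τ)] : ProbabilityMeasure (Avoiding n τ) :=
  ⟨biasedMeasure q n τ, isProbabilityMeasure_biasedMeasure hq n τ⟩

/-- `q / (3 + q)` is a valid success probability. -/
theorem bernoulliParam_mem {q : ℝ} (hq : 0 < q) : q / (3 + q) ∈ unitInterval :=
  ⟨by positivity, (div_le_one (by positivity)).2 (by linarith)⟩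

/-! Three fixed points form a pattern 123, so an avoider has at most two fixed points and only the
proportions of avoiders with 0, 1 or 2 of them matter. These tend to 9/16, 6/16 and 1/16. Weighting
by `q ^ fp` then gives limiting masses proportional to 9, 6q and q², the terms of (3 + q)², which is
the law of a sum of two independent Bernoulli(q / (3 + q)) variables. The number of avoiders of size
n is the Catalan number C_n = `ballot (2 * n) 0`, and C_n / C_{n+1} tends to 1/4.

The basic count is `card_cornerAvoiders`: 123-avoiding fillings of a rectangle with a forbidden
corner block, decreasing along the two sides of that block, are counted by ballot numbers. Peeling
off one cell of the corner reproduces the step recursion of nonnegative paths.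

Mean number of fixed points. A fixed point of an avoider cannot have both a point to its lower left
and a point to its upper right. If it has none to its lower left, with a indices below it and c ≥ a
above, the avoiders number `ballot (a + c) (c - a) ^ 2` (`card_hookAvoiders`); there are none if c <
a. Summed over the position this gives ∑ₖ `ballot (n - 1) k ^ 2` = C_{n-1}. The half-turn gives the
same total for the other kind, and the overlap is O(4ⁿ/n²), negligible against C_n, which has order
4ⁿ/n^(3/2). Hence the mean tends to 2/4 = 1/2.

Two fixed points. Two fixed points cut the rest of the diagram into two corner avoiders, linked only
through which middle rows and columns each one uses. Summing over all choices, for permutations of N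
+ 2 letters, gives D_0(N), where D_p(N) = `ballotConvSum p N`. With T_p(N) = ∑_{k ≥ p} `ballot N k ^
2`, so that T_0(N) = C_N, one has D_p(N+1) + D_p(N) - D_{p+1}(N) = T_p(N+1). The error e = D - T
therefore satisfies e_p(N+1) = e_{p+1}(N) - e_p(N) - `ballot N p ^ 2`: it at most doubles at each
step, apart from a forcing term of order 4^N/N², so it is O(4^N/N²) uniformly in p. Thus D_0(N) ~
C_N, and the proportion with two fixed points tends to (1/4)² = 1/16. The mean then gives 1/2 - 2/16
= 6/16 for one fixed point. -/

/-! ### Ballot numbers: closed form, bounds and sums of squares. -/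

/-- The number of lattice paths with `s` steps `±1` from `0` to `r` that stay nonnegative. -/
def ballot : ℕ → ℕ → ℕ
  | 0, 0 => 1
  | 0, _ + 1 => 0
  | s + 1, 0 => ballot s 1
  | s + 1, r + 1 => ballot s r + ballot s (r + 2)

theorem ballot_succ_zero (s : ℕ) : ballot (s + 1) 0 = ballot s 1 := by rw [ballot]

theorem ballot_succ_succ (s r : ℕ) :
    ballot (s + 1) (r + 1) = ballot s r + ballot s (r + 2) := by rw [ballot]

theorem ballot_eq_zero_of_lt : ∀ {s r : ℕ}, s < r → ballot s r = 0
  | 0, _ + 1, _ => by rw [ballot]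
  | s + 1, r + 1, h => by
    rw [ballot_succ_succ, ballot_eq_zero_of_lt (by omega), ballot_eq_zero_of_lt (by omega)]

theorem ballot_eq_zero_of_odd : ∀ {s r : ℕ}, Odd (s + r) → ballot s r = 0
  | 0, 0, h => by simp at h
  | 0, _ + 1, _ => by rw [ballot]
  | s + 1, 0, h => by
    rw [ballot_succ_zero, ballot_eq_zero_of_odd (by simpa using h)]
  | s + 1, r + 1, h => by
    rw [ballot_succ_succ, ballot_eq_zero_of_odd (by rw [Nat.odd_iff] at *; omega),
      ballot_eq_zero_of_odd (by rw [Nat.odd_iff] at *; omega)]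

/-- The reflection principle for ballot numbers. -/
theorem ballot_add_choose (s : ℕ) : ∀ e r : ℕ, s = 2 * e + r →
    ballot s r + (if e = 0 then 0 else s.choose (e - 1)) = s.choose e := by
  induction s with
  | zero =>
    intro e r h
    obtain ⟨rfl, rfl⟩ : e = 0 ∧ r = 0 := by omega
    simp [ballot]
  | succ s ih =>
    intro e r h
    rcases r with _ | r
    · obtain ⟨e, rfl⟩ : ∃ k, e = k + 1 := ⟨e - 1, by omega⟩
      have h1 := ih e 1 (by omega)
      have hs : s.choose (e + 1) = s.choose e := by
        rw [← Nat.choose_symm (n := s) (k := e) (by omega)]; congr 1; omega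
      rw [ballot_succ_zero, Nat.choose_succ_succ, hs]
      rcases e with _ | e
      · simp at h1 ⊢; omega
      · simp [Nat.choose_succ_succ] at h1 ⊢; omega
    · rcases e with _ | e
      · have h1 := ih 0 r (by omega)
        have h2 : ballot s (r + 2) = 0 := ballot_eq_zero_of_lt (by omega)
        simp at h1
        simp [ballot_succ_succ, h1, h2]
      · have h1 := ih (e + 1) r (by omega)
        have h2 := ih e (r + 2) (by omega)
        rw [ballot_succ_succ, Nat.choose_succ_succ]
        rcases e with _ | e
        · simp at h1 h2 ⊢; omega
        · simp [Nat.choose_succ_succ] at h1 h2 ⊢; omega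

theorem succ_mul_ballot (e r : ℕ) :
    (2 * e + r + 1) * ballot (2 * e + r) r = (r + 1) * (2 * e + r + 1).choose e := by
  have h := ballot_add_choose _ e r rfl
  rcases e with _ | e
  · simp at h; simp [h]
  · simp only [Nat.add_eq_zero_iff, one_ne_zero, and_false, if_false, Nat.add_sub_cancel] at h
    set s := 2 * (e + 1) + r with hs
    have h1 := Nat.choose_succ_right_eq s e
    have h2 : s - e = e + 2 + r := by omega
    rw [h2] at h1
    rw [Nat.choose_succ_succ]
    zify at *
    have hb : (ballot s r : ℤ) = s.choose (e + 1) - s.choose e := by linarith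
    rw [hb]
    have : (s : ℤ) = 2 * (e + 1) + r := by exact_mod_cast hs
    rw [this]
    linear_combination 2 * h1

theorem succ_mul_ballot_two_mul (n : ℕ) : (n + 1) * ballot (2 * n) 0 = n.centralBinom := by
  have h := ballot_add_choose _ n 0 rfl
  rcases n with _ | n
  · simp [ballot]
  · simp only [Nat.add_eq_zero_iff, one_ne_zero, and_false, if_false, Nat.add_sub_cancel,
      add_zero] at h
    rw [Nat.centralBinom]
    have h1 := Nat.choose_succ_right_eq (2 * (n + 1)) n
    have h2 : 2 * (n + 1) - n = n + 2 := by omega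
    rw [h2] at h1
    zify at *
    have hb : (ballot (2 * (n + 1)) 0 : ℤ)
      = (2 * (n + 1)).choose (n + 1) - (2 * (n + 1)).choose n := by linarith
    rw [hb]
    linear_combination h1

theorem choose_le_choose_of_two_mul_le {n k i : ℕ} (hki : k ≤ i) (hi : 2 * i ≤ n) :
    n.choose k ≤ n.choose i := by
  induction i, hki using Nat.le_induction with
  | base => exact le_rfl
  | succ i hki ih =>
    exact (ih (by omega)).trans (Nat.choose_le_succ_of_lt_half_left (by omega))

/-- In the closed form `(r + 1) * n.choose e`, with n = 2e + r + 1, the factor r + 1 is at most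
twice the number of indices from e to n / 2. The binomial coefficients increase over these indices
and sum to at most 2ⁿ = 2 · 2^s. -/
theorem succ_mul_ballot_le (s r : ℕ) : (s + 1) * ballot s r ≤ 4 * 2 ^ s := by
  by_cases hr : s < r
  · simp [ballot_eq_zero_of_lt hr]
  by_cases ho : Odd (s + r)
  · simp [ballot_eq_zero_of_odd ho]
  obtain ⟨e, rfl⟩ : ∃ e, s = 2 * e + r := by
    rw [Nat.not_odd_iff_even] at ho
    obtain ⟨k, hk⟩ := ho
    exact ⟨(s - r) / 2, by omega⟩
  rw [succ_mul_ballot]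
  set n := 2 * e + r + 1 with hn
  have h1 : (Finset.Icc e (n / 2)).card * n.choose e
      ≤ ∑ i ∈ Finset.Icc e (n / 2), n.choose i := by
    rw [← smul_eq_mul]
    refine Finset.card_nsmul_le_sum _ _ _ fun i hi => ?_
    rw [Finset.mem_Icc] at hi
    exact choose_le_choose_of_two_mul_le hi.1 (by omega)
  have h2 : ∑ i ∈ Finset.Icc e (n / 2), n.choose i ≤ 2 ^ n := by
    rw [← Nat.sum_range_choose]
    refine Finset.sum_le_sum_of_subset fun i hi => ?_
    rw [Finset.mem_Icc] at hi
    rw [Finset.mem_range]; omega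
  rw [Nat.card_Icc] at h1
  have h3 : r + 1 ≤ 2 * (n / 2 + 1 - e) := by omega
  calc (r + 1) * n.choose e ≤ 2 * (n / 2 + 1 - e) * n.choose e := Nat.mul_le_mul_right _ h3
    _ = 2 * ((n / 2 + 1 - e) * n.choose e) := by ring
    _ ≤ 2 * 2 ^ n := Nat.mul_le_mul_left _ (h1.trans h2)
    _ = 4 * 2 ^ (2 * e + r) := by rw [hn]; ring

/-- The step operator of the walk on the half-line is symmetric, so a step can be passed from one
factor to the other. The bounds `s < n` and `t < n` remove the boundary term at height n. -/
theorem sum_ballot_mul_shift (s t n : ℕ) (hs : s < n) (ht : t < n) :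
    ∑ k ∈ Finset.range n, ballot (s + 1) k * ballot t k
      = ∑ k ∈ Finset.range n, ballot s k * ballot (t + 1) k := by
  obtain ⟨n, rfl⟩ : ∃ m, n = m + 1 := ⟨n - 1, by omega⟩
  have key : ∀ u v : ℕ, u < n + 1 → v < n + 1 →
      ∑ k ∈ Finset.range (n + 1), ballot (u + 1) k * ballot v k
      = ∑ k ∈ Finset.range (n + 1), ballot u (k + 1) * ballot v k
        + ∑ k ∈ Finset.range (n + 1), ballot u k * ballot v (k + 1) := by
    intro u v hu hv
    rw [Finset.sum_range_succ' (fun k => ballot (u + 1) k * ballot v k),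
      Finset.sum_range_succ' (fun k => ballot u (k + 1) * ballot v k),
      Finset.sum_range_succ (fun k => ballot u k * ballot v (k + 1)),
      ballot_eq_zero_of_lt (s := v) (r := n + 1) hv]
    simp only [ballot_succ_succ, ballot_succ_zero, add_mul, Finset.sum_add_distrib]
    ring
  have h1 := key s t hs ht
  have h2 := key t s ht hs
  rw [h1]
  have h3 : ∑ k ∈ Finset.range (n + 1), ballot s k * ballot (t + 1) k
    = ∑ k ∈ Finset.range (n + 1), ballot (t + 1) k * ballot s k :=
    Finset.sum_congr rfl fun k _ => mul_comm _ _
  rw [h3, h2, add_comm]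
  simp only [mul_comm]

/-- A path of length s + t from 0 to 0 is cut at time s according to its height there, and the
second part is read backwards. -/
theorem sum_ballot_mul_ballot (s t n : ℕ) (h : s + t < n) :
    ∑ k ∈ Finset.range n, ballot s k * ballot t k = ballot (s + t) 0 := by
  induction s generalizing t with
  | zero =>
    rw [Finset.sum_eq_single 0]
    · simp [ballot]
    · rintro (_ | k) _ hk
      · exact absurd rfl hk
      · simp [ballot]
    · intro h0; simp at h0; omega
  | succ s ih =>
    rw [sum_ballot_mul_shift s t n (by omega) (by omega), ih (t + 1) (by omega)]
    congr 1; omega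

theorem sum_ballot_sq (s n : ℕ) (h : s < n) :
    ∑ k ∈ Finset.range n, ballot s k ^ 2 = ballot (2 * s) 0 := by
  -- The range is lengthened by s to satisfy `s + s < n + s`; the extra terms vanish because their
  -- height exceeds s.
  have h1 := sum_ballot_mul_ballot s s (n + s) (by omega)
  rw [Finset.sum_range_add, ← two_mul] at h1
  rw [← h1, Finset.sum_eq_zero (s := Finset.range s), add_zero]
  · simp only [sq]
  · intro k _
    rw [ballot_eq_zero_of_lt (by omega), zero_mul]

/-! ### The recurrence for the binomial convolutions of ballot numbers. -/

/-- The convolution of two shifted ballot sequences against the binomial weights `(2m choose r)`. -/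
def ballotConv (p s m : ℕ) : ℤ :=
  ∑ r ∈ Finset.HasAntidiagonal.antidiagonal (2 * m), ((2 * m).choose r.1 : ℤ) *
    ((ballot s (r.1 + p) : ℤ) * ballot s (r.2 + p))

/-- Pascal's rule applied twice produces the shifts (2, 0), (1, 1), (1, 1), (0, 2) of the two
heights. The outer two are the cross terms in the expansion of `ballotConv (p + 1) (s + 1) m` by the
step recursion, whose remaining terms are `ballotConv p s m` and `ballotConv (p + 2) s m`. Raising p
to p + 1 keeps that recursion off its boundary case at height 0. -/
theorem ballotConv_succ (p s m : ℕ) : ballotConv p s (m + 1) =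
    ballotConv (p + 1) (s + 1) m + 2 * ballotConv (p + 1) s m - ballotConv p s m
      - ballotConv (p + 2) s m := by
  have hc : ∀ f : ℕ → ℕ → ℤ,
      ∑ r ∈ Finset.HasAntidiagonal.antidiagonal (2 * m), ((2 * m).choose r.2 : ℤ) * f r.1 r.2
      = ∑ r ∈ Finset.HasAntidiagonal.antidiagonal (2 * m), ((2 * m).choose r.1 : ℤ) * f r.1 r.2 := by
    intro f
    refine Finset.sum_congr rfl fun r hr => ?_
    rw [Finset.HasAntidiagonal.mem_antidiagonal] at hr
    rw [Nat.choose_symm_of_eq_add (show 2 * m = r.1 + r.2 by omega)]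
  have hc1 : ∀ f : ℕ → ℕ → ℤ,
      ∑ r ∈ Finset.HasAntidiagonal.antidiagonal (2 * m + 1), ((2 * m + 1).choose r.2 : ℤ) * f r.1 r.2
      = ∑ r ∈ Finset.HasAntidiagonal.antidiagonal (2 * m + 1), ((2 * m + 1).choose r.1 : ℤ) * f r.1 r.2 := by
    intro f
    refine Finset.sum_congr rfl fun r hr => ?_
    rw [Finset.HasAntidiagonal.mem_antidiagonal] at hr
    rw [Nat.choose_symm_of_eq_add (show 2 * m + 1 = r.1 + r.2 by omega)]
  unfold ballotConv
  rw [show 2 * (m + 1) = 2 * m + 1 + 1 by ring,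
    Finset.sum_antidiagonal_choose_succ_mul
      (fun i j => (ballot s (i + p) : ℤ) * ballot s (j + p)),
    hc1 (fun i j => (ballot s (i + 1 + p) : ℤ) * ballot s (j + p)),
    Finset.sum_antidiagonal_choose_succ_mul
      (fun i j => (ballot s (i + p) : ℤ) * ballot s (j + 1 + p)),
    Finset.sum_antidiagonal_choose_succ_mul
      (fun i j => (ballot s (i + 1 + p) : ℤ) * ballot s (j + p)),
    hc (fun i j => (ballot s (i + 1 + p) : ℤ) * ballot s (j + 1 + p)),
    hc (fun i j => (ballot s (i + 1 + 1 + p) : ℤ) * ballot s (j + p)), Finset.mul_sum]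
  simp only [← Finset.sum_add_distrib, ← Finset.sum_sub_distrib]
  refine Finset.sum_congr rfl fun r _ => ?_
  simp only [← add_assoc, ballot_succ_succ, Nat.cast_add]
  simp only [show ∀ x : ℕ, x + 1 + 1 + p = x + p + 2 by intros; ring,
    show ∀ x : ℕ, x + 1 + p = x + p + 1 by intros; ring]
  ring

/-- The sum of `ballotConv p s m` over `s + m = N`. -/
def ballotConvSum (p N : ℕ) : ℤ := ∑ m ∈ Finset.range (N + 1), ballotConv p (N - m) m

/-- The tail `∑_{k ≥ p} (ballot N k)²`. -/
def ballotSqTail (p N : ℕ) : ℤ := ∑ k ∈ Finset.Ico p (N + 1), (ballot N k : ℤ) ^ 2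

theorem ballotSqTail_eq (p N : ℕ) :
    ballotSqTail p N = (ballot N p : ℤ) ^ 2 + ballotSqTail (p + 1) N := by
  unfold ballotSqTail
  by_cases h : p < N + 1
  · rw [Finset.sum_eq_sum_Ico_succ_bot h]
  · rw [Finset.Ico_eq_empty (by omega), Finset.Ico_eq_empty (by omega),
      ballot_eq_zero_of_lt (by omega)]
    simp

theorem ballotConv_zero_right (p s : ℕ) : ballotConv p s 0 = (ballot s p : ℤ) ^ 2 := by
  simp [ballotConv, sq]

theorem ballotConv_zero_left (p m : ℕ) : ballotConv (p + 1) 0 m = 0 := by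
  simp [ballotConv, ballot]

theorem ballotConv_eq_zero {p s m : ℕ} (h : s < p) : ballotConv p s m = 0 := by
  refine Finset.sum_eq_zero fun r _ => ?_
  rw [ballot_eq_zero_of_lt (show s < r.1 + p by omega)]; simp

theorem ballotConvSum_eq_zero {p N : ℕ} (h : N < p) : ballotConvSum p N = 0 :=
  Finset.sum_eq_zero fun _ _ => ballotConv_eq_zero (by omega)

/-- This is `ballotConv_succ` summed over s + m = N. The square is the term m = 0 that the shift in
m leaves over; on the p + 1 side the leftover term has s = 0 at positive height and vanishes. -/
theorem ballotConvSum_step (p N : ℕ) :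
    ballotConvSum p (N + 1) + ballotConvSum p N - ballotConvSum (p + 1) N =
      (ballot (N + 1) p : ℤ) ^ 2 + (ballotConvSum (p + 1) (N + 1) + ballotConvSum (p + 1) N
        - ballotConvSum (p + 2) N) := by
  have h1 : ballotConvSum p (N + 1)
      = (∑ m ∈ Finset.range (N + 1), ballotConv p (N - m) (m + 1)) + (ballot (N + 1) p : ℤ) ^ 2 := by
    rw [ballotConvSum, Finset.sum_range_succ', ballotConv_zero_right, Nat.sub_zero]
    congr 1
    exact Finset.sum_congr rfl fun m _ => by rw [Nat.add_sub_add_right]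
  have h2 : ballotConvSum (p + 1) (N + 1)
      = ∑ m ∈ Finset.range (N + 1), ballotConv (p + 1) (N - m + 1) m := by
    rw [ballotConvSum, Finset.sum_range_succ, Nat.sub_self, ballotConv_zero_left, add_zero]
    refine Finset.sum_congr rfl fun m hm => ?_
    rw [Finset.mem_range] at hm
    rw [show N + 1 - m = N - m + 1 by omega]
  rw [h1, h2]
  simp only [ballotConvSum, ballotConv_succ, Finset.sum_add_distrib, Finset.sum_sub_distrib,
    ← Finset.mul_sum]
  ring

/-- By `ballotConvSum_step` and `ballotSqTail_eq`, both sides change by the same square when p is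
replaced by p + 1, and both vanish once p > N + 1. The induction therefore runs downwards in p. -/
theorem ballotConvSum_recurrence (p N : ℕ) :
    ballotConvSum p (N + 1) + ballotConvSum p N - ballotConvSum (p + 1) N
      = ballotSqTail p (N + 1) := by
  by_cases h : N + 1 < p
  · rw [ballotConvSum_eq_zero h, ballotConvSum_eq_zero (by omega), ballotConvSum_eq_zero (by omega),
      ballotSqTail, Finset.Ico_eq_empty (by omega)]
    simp
  · rw [ballotConvSum_step, ballotConvSum_recurrence (p + 1) N, ← ballotSqTail_eq]
termination_by N + 2 - p

/-! ### The convolution sum is asymptotically a Catalan number. -/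

theorem ballot_sq_le (s r : ℕ) : (ballot s r : ℝ) ^ 2 ≤ 144 * (4 ^ s / (s + 3) ^ 2) := by
  have h : ((s : ℝ) + 1) * ballot s r ≤ 4 * 2 ^ s := by exact_mod_cast succ_mul_ballot_le s r
  -- Since s + 3 ≤ 3(s + 1), the constant 4 becomes 12, and 144 = 12².
  have h1 : ((s : ℝ) + 3) * ballot s r ≤ 12 * 2 ^ s := by
    have : (0 : ℝ) ≤ ballot s r := by positivity
    nlinarith [mul_nonneg (Nat.cast_nonneg (α := ℝ) s) this]
  rw [← mul_div_assoc, le_div_iff₀ (by positivity)]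
  calc (ballot s r : ℝ) ^ 2 * ((s : ℝ) + 3) ^ 2 = (((s : ℝ) + 3) * ballot s r) ^ 2 := by ring
    _ ≤ (12 * 2 ^ s) ^ 2 := by gcongr
    _ = 144 * 4 ^ s := by rw [mul_pow, ← pow_mul, mul_comm s 2, pow_mul]; norm_num

/-- The bound has to be uniform in p because the recurrence for the error couples p with p + 1. The
error at most doubles at each step while 4^N quadruples, which leaves room for the forcing term
`ballot N p ^ 2`. -/
theorem abs_ballotConvSum_sub_le (N : ℕ) : ∀ p : ℕ,
    |(ballotConvSum p N : ℝ) - ballotSqTail p N| ≤ 648 * (4 ^ N / (N + 3) ^ 2) := by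
  induction N with
  | zero =>
    intro p
    have : ballotConvSum p 0 = ballotSqTail p 0 := by
      rw [ballotConvSum, Finset.sum_range_one, ballotConv_zero_right, ballotSqTail]
      rcases p with _ | p
      · simp
      · simp [ballot]
    rw [this, sub_self, abs_zero]; positivity
  | succ N ih =>
    intro p
    have h := ballotConvSum_recurrence p N
    have ht := ballotSqTail_eq p N
    have h' : (ballotConvSum p (N + 1) : ℝ) - ballotSqTail p (N + 1)
        = ((ballotConvSum (p + 1) N : ℝ) - ballotSqTail (p + 1) N)
          - ((ballotConvSum p N : ℝ) - ballotSqTail p N) - (ballot N p : ℝ) ^ 2 := by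
      have h2 : (ballotConvSum p (N + 1) : ℝ) + ballotConvSum p N - ballotConvSum (p + 1) N
        = ballotSqTail p (N + 1) := by exact_mod_cast h
      have h3 : (ballotSqTail p N : ℝ) = (ballot N p : ℝ) ^ 2 + ballotSqTail (p + 1) N := by
        exact_mod_cast ht
      linarith
    rw [h']
    -- The ratio ((N + 4) / (N + 3))² is at most 16/9, its value at N = 0. The shift 3 makes it less
    -- than 2, so doubling is beaten by the factor 4; the induction closes because (2 · 648 + 144) ·
    -- (16/9) / 4 = 640 ≤ 648.
    have hN : (4 : ℝ) ^ N / ((N : ℝ) + 3) ^ 2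
        ≤ 16 / 9 * (4 ^ N / (((N + 1 : ℕ) : ℝ) + 3) ^ 2) := by
      rw [← mul_div_assoc, div_le_div_iff₀ (by positivity) (by positivity)]
      have h4 : (0 : ℝ) < 4 ^ N := by positivity
      have h5 : (((N + 1 : ℕ) : ℝ) + 3) ^ 2 ≤ 16 / 9 * ((N : ℝ) + 3) ^ 2 := by
        push_cast; nlinarith [Nat.cast_nonneg (α := ℝ) N]
      nlinarith
    have e1 := abs_le.1 (ih (p + 1))
    have e2 := abs_le.1 (ih p)
    have e3 := ballot_sq_le N p
    have e4 : (0 : ℝ) ≤ (ballot N p : ℝ) ^ 2 := by positivity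
    have e5 : (0 : ℝ) ≤ 4 ^ N / ((((N + 1 : ℕ) : ℝ)) + 3) ^ 2 := by positivity
    rw [pow_succ (4 : ℝ) N, mul_div_right_comm, abs_le]
    constructor <;> nlinarith

theorem ballotSqTail_zero (N : ℕ) : ballotSqTail 0 N = ballot (2 * N) 0 := by
  rw [← sum_ballot_sq N (N + 1) (by omega), ballotSqTail, ← Finset.range_eq_Ico]
  push_cast; rfl

/-! ### Corner avoiders and the peeling of one cell of the corner. -/

/-- `S` is the graph of a bijection from `I` onto `J`. -/
structure IsBijGraph (I J : Finset ℤ) (S : Finset (ℤ × ℤ)) : Prop where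
  fst_mem : ∀ {x y}, (x, y) ∈ S → x ∈ I
  snd_mem : ∀ {x y}, (x, y) ∈ S → y ∈ J
  exists_snd : ∀ {x}, x ∈ I → ∃ y, (x, y) ∈ S
  exists_fst : ∀ {y}, y ∈ J → ∃ x, (x, y) ∈ S
  snd_unique : ∀ {x y y'}, (x, y) ∈ S → (x, y') ∈ S → y = y'
  fst_unique : ∀ {x x' y}, (x, y) ∈ S → (x', y) ∈ S → x = x'

/-- No three points of `S` are in the relative order `123`. -/
def Avoids123 (S : Finset (ℤ × ℤ)) : Prop :=
  ∀ ⦃x₁ y₁ x₂ y₂ x₃ y₃ : ℤ⦄, (x₁, y₁) ∈ S → (x₂, y₂) ∈ S → (x₃, y₃) ∈ S →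
    x₁ < x₂ → x₂ < x₃ → y₁ < y₂ → y₂ < y₃ → False

/-- `S` is the graph of a `123`-avoiding bijection from `P ∪ Q` onto `L ∪ H` that sends no point of
`Q` into `L` and is decreasing both on `Q` and on the preimage of `L`. -/
structure IsCornerAvoider (P Q L H : Finset ℤ) (S : Finset (ℤ × ℤ)) : Prop where
  bij : IsBijGraph (P ∪ Q) (L ∪ H) S
  avoids : Avoids123 S
  corner : ∀ {x y}, (x, y) ∈ S → x ∈ Q → y ∉ L
  anti_fst : ∀ {x y x' y'}, (x, y) ∈ S → (x', y') ∈ S → x ∈ Q → x' ∈ Q → x < x' → y' < y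
  anti_snd : ∀ {x y x' y'}, (x, y) ∈ S → (x', y') ∈ S → y ∈ L → y' ∈ L → x < x' → y' < y

/-- The set of all `S` with `IsCornerAvoider P Q L H S`. -/
noncomputable def cornerAvoiders (P Q L H : Finset ℤ) : Finset (Finset (ℤ × ℤ)) :=
  letI := Classical.decPred (IsCornerAvoider P Q L H)
  ((P ∪ Q) ×ˢ (L ∪ H)).powerset.filter (IsCornerAvoider P Q L H)

theorem mem_cornerAvoiders {P Q L H : Finset ℤ} {S : Finset (ℤ × ℤ)} :
    S ∈ cornerAvoiders P Q L H ↔ IsCornerAvoider P Q L H S := by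
  classical
  rw [cornerAvoiders, Finset.mem_filter, Finset.mem_powerset, and_iff_right_iff_imp]
  rintro h ⟨x, y⟩ hxy
  exact Finset.mem_product.2 ⟨h.bij.fst_mem hxy, h.bij.snd_mem hxy⟩

section Step

variable {P Q L H : Finset ℤ} {q l : ℤ} {S : Finset (ℤ × ℤ)}

/-- The preimage x₀ of the least value l lies to the left of q: it is not in Q by the corner
condition, and it is not q. If q took a value in L, the order on the preimage of L would force that
value below l. If q and a later point of Q were in increasing order, they would form a 123 with (x₀,
l). -/
theorem IsCornerAvoider.move (hP : ∀ p ∈ P, p < q) (hQ : ∀ x ∈ Q, q < x)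
    (hL : ∀ y ∈ L, l < y) (hH : ∀ y ∈ H, l < y)
    (h : IsCornerAvoider (insert q P) Q (insert l L) H S) (hql : (q, l) ∉ S) :
    IsCornerAvoider P (insert q Q) (insert l L) H S := by
  obtain ⟨x₀, hx₀⟩ := h.bij.exists_fst (y := l) (by simp)
  have hx₀q : x₀ < q := by
    have h1 := h.bij.fst_mem hx₀
    have h2 := fun hx => h.corner hx₀ hx (Finset.mem_insert_self l L)
    grind
  have hbij := h.bij
  rw [show insert q P ∪ Q = P ∪ insert q Q by grind] at hbij
  refine ⟨hbij, h.avoids, ?_, ?_, h.anti_snd⟩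
  · intro x y hxy hx hy
    rcases Finset.mem_insert.1 hx with rfl | hx
    · rcases Finset.mem_insert.1 hy with rfl | hy'
      · exact hql hxy
      · exact absurd (h.anti_snd hx₀ hxy (by simp) hy hx₀q) (hL y hy').not_gt
    · exact h.corner hxy hx hy
  · intro x y x' y' hxy hxy' hx hx' hlt
    rcases Finset.mem_insert.1 hx' with rfl | hx'
    · grind
    rcases Finset.mem_insert.1 hx with rfl | hx
    · by_contra! hy
      rcases hy.lt_or_eq with hy | rfl
      · refine h.avoids hx₀ hxy hxy' hx₀q hlt ?_ hy
        have h1 := h.bij.snd_mem hxy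
        have h2 : y ≠ l := by rintro rfl; exact hql hxy
        grind
      · exact hlt.ne (h.bij.fst_unique hxy hxy')
    · exact h.anti_fst hxy hxy' hx hx' hlt

theorem IsCornerAvoider.unmove (h : IsCornerAvoider P (insert q Q) L H S) :
    IsCornerAvoider (insert q P) Q L H S := by
  have hbij := h.bij
  rw [show P ∪ insert q Q = insert q P ∪ Q by grind] at hbij
  exact ⟨hbij, h.avoids, fun hxy hx => h.corner hxy (Finset.mem_insert_of_mem hx),
    fun h1 h2 h3 h4 => h.anti_fst h1 h2 (Finset.mem_insert_of_mem h3)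
      (Finset.mem_insert_of_mem h4), h.anti_snd⟩

theorem IsCornerAvoider.erase (hP : ∀ p ∈ P, p < q) (hQ : ∀ x ∈ Q, q < x)
    (hL : ∀ y ∈ L, l < y) (hH : ∀ y ∈ H, l < y)
    (h : IsCornerAvoider (insert q P) Q (insert l L) H S) (hql : (q, l) ∈ S) :
    IsCornerAvoider P Q L H (S.erase (q, l)) := by
  have hne1 : ∀ {x y}, (x, y) ∈ S → (x, y) ≠ (q, l) → x ≠ q := by
    rintro x y hxy hne rfl; exact hne (by rw [h.bij.snd_unique hxy hql])
  have hne2 : ∀ {x y}, (x, y) ∈ S → (x, y) ≠ (q, l) → y ≠ l := by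
    rintro x y hxy hne rfl; exact hne (by rw [h.bij.fst_unique hxy hql])
  refine ⟨⟨?_, ?_, ?_, ?_, ?_, ?_⟩, ?_, ?_, ?_, ?_⟩
  · intro x y hxy
    have h1 := h.bij.fst_mem (Finset.mem_of_mem_erase hxy)
    have h2 := hne1 (Finset.mem_of_mem_erase hxy) (Finset.ne_of_mem_erase hxy)
    grind
  · intro x y hxy
    have h1 := h.bij.snd_mem (Finset.mem_of_mem_erase hxy)
    have h2 := hne2 (Finset.mem_of_mem_erase hxy) (Finset.ne_of_mem_erase hxy)
    grind
  · intro x hx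
    obtain ⟨y, hy⟩ := h.bij.exists_snd (x := x) (by grind)
    exact ⟨y, by grind⟩
  · intro y hy
    obtain ⟨x, hx⟩ := h.bij.exists_fst (y := y) (by grind)
    exact ⟨x, by grind⟩
  · exact fun h1 h2 => h.bij.snd_unique (Finset.mem_of_mem_erase h1) (Finset.mem_of_mem_erase h2)
  · exact fun h1 h2 => h.bij.fst_unique (Finset.mem_of_mem_erase h1) (Finset.mem_of_mem_erase h2)
  · exact fun _ _ _ _ _ _ h1 h2 h3 => h.avoids (Finset.mem_of_mem_erase h1)
      (Finset.mem_of_mem_erase h2) (Finset.mem_of_mem_erase h3)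
  · exact fun h1 h2 h3 => h.corner (Finset.mem_of_mem_erase h1) h2 (Finset.mem_insert_of_mem h3)
  · exact fun h1 h2 => h.anti_fst (Finset.mem_of_mem_erase h1) (Finset.mem_of_mem_erase h2)
  · exact fun h1 h2 h3 h4 => h.anti_snd (Finset.mem_of_mem_erase h1) (Finset.mem_of_mem_erase h2)
      (Finset.mem_insert_of_mem h3) (Finset.mem_insert_of_mem h4)

/-- As l is the least value, (q, l) could only be the first point of a 123; the other two would then
have positions in Q, where the graph is decreasing. No point to the right of q has a value in L, so
the preimage of L stays decreasing. -/
theorem IsCornerAvoider.insert (hP : ∀ p ∈ P, p < q) (hQ : ∀ x ∈ Q, q < x)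
    (hL : ∀ y ∈ L, l < y) (hH : ∀ y ∈ H, l < y) (h : IsCornerAvoider P Q L H S) :
    IsCornerAvoider (insert q P) Q (insert l L) H (insert (q, l) S) := by
  have hx : ∀ {x y}, (x, y) ∈ S → x ∈ P ∨ x ∈ Q := fun hxy => by
    simpa using h.bij.fst_mem hxy
  have hy : ∀ {x y}, (x, y) ∈ S → l < y := fun hxy => by
    have := h.bij.snd_mem hxy; grind
  have hm : ∀ {x y}, (x, y) ∈ Insert.insert (q, l) S ↔ (x = q ∧ y = l) ∨ (x, y) ∈ S := by
    intro x y; simp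
  have hxq : ∀ {x y}, (x, y) ∈ S → x ≠ q := fun hxy => by
    have := hx hxy; grind
  refine ⟨⟨?_, ?_, ?_, ?_, ?_, ?_⟩, ?_, ?_, ?_, ?_⟩
  · intro x y hxy
    rcases hm.1 hxy with ⟨rfl, rfl⟩ | hxy
    · simp
    · have := hx hxy; grind
  · intro x y hxy
    rcases hm.1 hxy with ⟨rfl, rfl⟩ | hxy
    · simp
    · have := h.bij.snd_mem hxy; grind
  · intro x hx
    by_cases hxq : x = q
    · exact ⟨l, hm.2 (Or.inl ⟨hxq, rfl⟩)⟩
    · obtain ⟨y, hy⟩ := h.bij.exists_snd (x := x) (by grind)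
      exact ⟨y, hm.2 (Or.inr hy)⟩
  · intro y hy
    by_cases hyl : y = l
    · exact ⟨q, hm.2 (Or.inl ⟨rfl, hyl⟩)⟩
    · obtain ⟨x, hx⟩ := h.bij.exists_fst (y := y) (by grind)
      exact ⟨x, hm.2 (Or.inr hx)⟩
  · intro x y y' h1 h2
    rcases hm.1 h1 with ⟨rfl, rfl⟩ | k1 <;> rcases hm.1 h2 with ⟨k2, rfl⟩ | k2
    · rfl
    · exact absurd rfl (hxq k2)
    · exact absurd k2 (hxq k1)
    · exact h.bij.snd_unique k1 k2
  · intro x x' y h1 h2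
    rcases hm.1 h1 with ⟨rfl, rfl⟩ | k1 <;> rcases hm.1 h2 with ⟨rfl, k2⟩ | k2
    · rfl
    · exact absurd (hy k2) (lt_irrefl _)
    · exact absurd (hy k1) (by omega)
    · exact h.bij.fst_unique k1 k2
  · intro x₁ y₁ x₂ y₂ x₃ y₃ h1 h2 h3 a b c d
    have h3' : (x₃, y₃) ∈ S := by
      rcases hm.1 h3 with ⟨rfl, rfl⟩ | h3
      · rcases hm.1 h2 with ⟨rfl, rfl⟩ | h2
        · exact absurd d (lt_irrefl _)
        · exact absurd (hy h2) d.not_gt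
      · exact h3
    have h2' : (x₂, y₂) ∈ S := by
      rcases hm.1 h2 with ⟨rfl, rfl⟩ | h2
      · rcases hm.1 h1 with ⟨rfl, rfl⟩ | h1
        · exact absurd c (lt_irrefl _)
        · exact absurd (hy h1) c.not_gt
      · exact h2
    rcases hm.1 h1 with ⟨rfl, rfl⟩ | h1
    · have e2 := hx h2'
      have e3 := hx h3'
      exact absurd (h.anti_fst h2' h3' (by grind) (by grind) b) d.not_gt
    · exact h.avoids h1 h2' h3' a b c d
  · intro x y hxy hxQ hyL
    rcases hm.1 hxy with ⟨rfl, rfl⟩ | hxy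
    · exact absurd (hQ _ hxQ) (lt_irrefl _)
    · exact h.corner hxy hxQ (by have := hy hxy; grind)
  · intro x y x' y' h1 h2 h3 h4
    rcases hm.1 h1 with ⟨rfl, rfl⟩ | h1
    · exact absurd (hQ _ h3) (lt_irrefl _)
    rcases hm.1 h2 with ⟨rfl, rfl⟩ | h2
    · exact absurd (hQ _ h4) (lt_irrefl _)
    exact h.anti_fst h1 h2 h3 h4
  · intro x y x' y' h1 h2 h3 h4 hlt
    rcases hm.1 h1 with ⟨rfl, rfl⟩ | k1
    · rcases hm.1 h2 with ⟨rfl, rfl⟩ | k2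
      · exact absurd hlt (lt_irrefl _)
      · have e1 := hx k2
        exact absurd (h.corner k2 (by grind)) (by have := hy k2; grind)
    · rcases hm.1 h2 with ⟨rfl, rfl⟩ | k2
      · exact hy k1
      · exact h.anti_snd k1 k2 (by have := hy k1; grind) (by have := hy k2; grind) hlt

/-- The two summands are the cases (q, l) ∈ S, where the point is deleted, and (q, l) ∉ S, where q
joins Q without any change to S. -/
theorem card_cornerAvoiders_insert (hP : ∀ p ∈ P, p < q) (hQ : ∀ x ∈ Q, q < x)
    (hL : ∀ y ∈ L, l < y) (hH : ∀ y ∈ H, l < y) :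
    (cornerAvoiders (insert q P) Q (insert l L) H).card =
      (cornerAvoiders P Q L H).card + (cornerAvoiders P (insert q Q) (insert l L) H).card := by
  classical
  rw [← Finset.card_filter_add_card_filter_not (fun S => (q, l) ∈ S)]
  congr 1
  · refine Finset.card_nbij' (fun S => S.erase (q, l)) (fun S => insert (q, l) S) ?_ ?_ ?_ ?_
    · intro S hS
      simp only [Finset.coe_filter, Set.mem_ofPred_eq, mem_cornerAvoiders] at hS
      exact mem_cornerAvoiders.2 (hS.1.erase hP hQ hL hH hS.2)
    · intro S hS
      simp only [Finset.coe_filter, Set.mem_ofPred_eq, mem_cornerAvoiders]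
      exact ⟨(mem_cornerAvoiders.1 hS).insert hP hQ hL hH, by simp⟩
    · intro S hS
      simp only [Finset.coe_filter, Set.mem_ofPred_eq] at hS
      exact Finset.insert_erase hS.2
    · intro S hS
      refine Finset.erase_insert fun hql => ?_
      have := (mem_cornerAvoiders.1 hS).bij.snd_mem hql
      grind
  · congr 1
    ext S
    simp only [Finset.mem_filter, mem_cornerAvoiders]
    exact ⟨fun h => h.1.move hP hQ hL hH h.2,
      fun h => ⟨h.unmove, fun hql => h.corner hql (by simp) (by simp)⟩⟩

end Step

/-! ### Reflection in the antidiagonal, which exchanges the roles of Q and L. -/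

section Neg

/-- The reflection `(x, y) ↦ (-y, -x)` of a set of points. -/
def antiTranspose (S : Finset (ℤ × ℤ)) : Finset (ℤ × ℤ) :=
  S.map ((Equiv.prodComm ℤ ℤ).trans ((Equiv.neg ℤ).prodCongr (Equiv.neg ℤ))).toEmbedding

/-- The reflection `x ↦ -x` of a set of integers. -/
def negSet (I : Finset ℤ) : Finset ℤ := I.map (Equiv.neg ℤ).toEmbedding

theorem mem_antiTranspose {S : Finset (ℤ × ℤ)} {x y : ℤ} :
    (x, y) ∈ antiTranspose S ↔ (-y, -x) ∈ S := by
  simp only [antiTranspose, Finset.mem_map_equiv]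
  rfl

theorem mem_negSet {I : Finset ℤ} {x : ℤ} : x ∈ negSet I ↔ -x ∈ I := by
  simp only [negSet, Finset.mem_map_equiv]
  rfl

theorem card_negSet (I : Finset ℤ) : (negSet I).card = I.card := Finset.card_map _

theorem negSet_negSet (I : Finset ℤ) : negSet (negSet I) = I := by
  ext x; simp [mem_negSet]

theorem antiTranspose_antiTranspose (S : Finset (ℤ × ℤ)) :
    antiTranspose (antiTranspose S) = S := by
  ext ⟨x, y⟩; simp [mem_antiTranspose]

theorem negSet_union (I J : Finset ℤ) : negSet (I ∪ J) = negSet I ∪ negSet J := by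
  ext x; simp [mem_negSet]

variable {I J P Q L H : Finset ℤ} {S : Finset (ℤ × ℤ)}

theorem IsBijGraph.antiTranspose (h : IsBijGraph I J S) :
    IsBijGraph (negSet J) (negSet I) (antiTranspose S) where
  fst_mem hxy := mem_negSet.2 (h.snd_mem (mem_antiTranspose.1 hxy))
  snd_mem hxy := mem_negSet.2 (h.fst_mem (mem_antiTranspose.1 hxy))
  exists_snd {x} hx := by
    obtain ⟨y, hy⟩ := h.exists_fst (mem_negSet.1 hx)
    exact ⟨-y, mem_antiTranspose.2 (by rwa [neg_neg])⟩
  exists_fst {x} hx := by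
    obtain ⟨y, hy⟩ := h.exists_snd (mem_negSet.1 hx)
    exact ⟨-y, mem_antiTranspose.2 (by rwa [neg_neg])⟩
  snd_unique h1 h2 :=
    neg_injective (h.fst_unique (mem_antiTranspose.1 h1) (mem_antiTranspose.1 h2))
  fst_unique h1 h2 :=
    neg_injective (h.snd_unique (mem_antiTranspose.1 h1) (mem_antiTranspose.1 h2))

theorem Avoids123.antiTranspose (h : Avoids123 S) : Avoids123 (antiTranspose S) :=
  fun _ _ _ _ _ _ h1 h2 h3 a b c d =>
    h (mem_antiTranspose.1 h3) (mem_antiTranspose.1 h2) (mem_antiTranspose.1 h1)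
      (neg_lt_neg d) (neg_lt_neg c) (neg_lt_neg b) (neg_lt_neg a)

theorem IsCornerAvoider.antiTranspose (h : IsCornerAvoider P Q L H S) :
    IsCornerAvoider (negSet H) (negSet L) (negSet Q) (negSet P) (antiTranspose S) where
  bij := by
    have := h.bij.antiTranspose
    rwa [negSet_union, negSet_union, Finset.union_comm (negSet L),
      Finset.union_comm (negSet P)] at this
  avoids := h.avoids.antiTranspose
  corner hxy hx hy :=
    h.corner (mem_antiTranspose.1 hxy) (mem_negSet.1 hy) (mem_negSet.1 hx)
  anti_fst {x y x' y'} h1 h2 h3 h4 hlt := by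
    have k1 := mem_antiTranspose.1 h1
    have k2 := mem_antiTranspose.1 h2
    by_contra! hy
    rcases hy.lt_or_eq with hy | rfl
    · exact (h.anti_snd k2 k1 (mem_negSet.1 h4) (mem_negSet.1 h3) (neg_lt_neg hy)).not_gt
        (neg_lt_neg hlt)
    · exact hlt.ne (neg_injective (h.bij.snd_unique k1 k2))
  anti_snd {x y x' y'} h1 h2 h3 h4 hlt := by
    have k1 := mem_antiTranspose.1 h1
    have k2 := mem_antiTranspose.1 h2
    by_contra! hy
    rcases hy.lt_or_eq with hy | rfl
    · exact (h.anti_fst k2 k1 (mem_negSet.1 h4) (mem_negSet.1 h3) (neg_lt_neg hy)).not_gt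
        (neg_lt_neg hlt)
    · exact hlt.ne (neg_injective (h.bij.snd_unique k1 k2))

theorem card_cornerAvoiders_negSet (P Q L H : Finset ℤ) :
    (cornerAvoiders (negSet H) (negSet L) (negSet Q) (negSet P)).card
      = (cornerAvoiders P Q L H).card := by
  symm
  refine Finset.card_nbij' antiTranspose antiTranspose ?_ ?_ ?_ ?_
  · exact fun S hS => mem_cornerAvoiders.2 (mem_cornerAvoiders.1 hS).antiTranspose
  · intro S hS
    have := (mem_cornerAvoiders.1 hS).antiTranspose
    simp only [negSet_negSet] at this
    exact mem_cornerAvoiders.2 this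
  · exact fun S _ => antiTranspose_antiTranspose S
  · exact fun S _ => antiTranspose_antiTranspose S

end Neg

/-! ### Counting corner avoiders by ballot numbers. -/

theorem cornerAvoiders_empty_left {Q L H : Finset ℤ} {l : ℤ} (hl : l ∈ L) : cornerAvoiders ∅ Q L H = ∅ := by
  refine Finset.eq_empty_of_forall_notMem fun S hS => ?_
  have h := mem_cornerAvoiders.1 hS
  obtain ⟨x, hx⟩ := h.bij.exists_fst (y := l) (by grind)
  exact h.corner hx (by have := h.bij.fst_mem hx; grind) hl

/-- Being decreasing on one point is no condition. This is the boundary case `ballot (s + 1) 0 =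
ballot s 1` of the recursion. -/
theorem cornerAvoiders_singleton_right {P H : Finset ℤ} {q : ℤ} :
    cornerAvoiders (insert q P) ∅ ∅ H = cornerAvoiders P {q} ∅ H := by
  ext S
  rw [mem_cornerAvoiders, mem_cornerAvoiders]
  refine ⟨fun h => ⟨?_, h.avoids, by simp, ?_, by simp⟩,
    fun h => ⟨?_, h.avoids, by simp, by simp, by simp⟩⟩
  · have := h.bij
    rwa [show insert q P ∪ ∅ = P ∪ {q} by grind] at this
  · intro x y x' y' _ _ h3 h4 h5
    grind
  · have := h.bij
    rwa [show P ∪ {q} = insert q P ∪ ∅ by grind] at this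

theorem cornerAvoiders_empty : cornerAvoiders ∅ ∅ ∅ ∅ = {∅} := by
  ext S
  rw [mem_cornerAvoiders, Finset.mem_singleton]
  constructor
  · intro h
    refine Finset.eq_empty_of_forall_notMem ?_
    rintro ⟨x, y⟩ hxy
    simpa using h.bij.fst_mem hxy
  · rintro rfl
    exact ⟨⟨by simp, by simp, by simp, by simp, by simp, by simp⟩, by simp [Avoids123],
      by simp, by simp, by simp⟩

/-- The number of corner avoiders is a ballot number. -/
theorem card_cornerAvoiders (s : ℕ) : ∀ P Q L H : Finset ℤ, (∀ x ∈ P, ∀ y ∈ Q, x < y) →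
    (∀ x ∈ L, ∀ y ∈ H, x < y) → P.card + Q.card = L.card + H.card → P.card + H.card = s →
    (cornerAvoiders P Q L H).card = ballot s (Q.card + L.card) := by
  induction s with
  | zero =>
    intro P Q L H hPQ hLH hc hs
    obtain ⟨rfl, rfl⟩ : P = ∅ ∧ H = ∅ := by
      rw [← Finset.card_eq_zero, ← Finset.card_eq_zero]; omega
    rcases L.eq_empty_or_nonempty with rfl | ⟨l, hl⟩
    · obtain rfl : Q = ∅ := by rw [← Finset.card_eq_zero]; simpa using hc
      simp [cornerAvoiders_empty, ballot]
    · rw [cornerAvoiders_empty_left hl, Finset.card_empty, ballot_eq_zero_of_lt]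
      have := Finset.card_pos.2 ⟨l, hl⟩
      omega
  | succ s ih =>
    have key : ∀ P Q L H : Finset ℤ, (∀ x ∈ P, ∀ y ∈ Q, x < y) →
        (∀ x ∈ L, ∀ y ∈ H, x < y) → P.card + Q.card = L.card + H.card → P.card + H.card = s + 1 →
        L.Nonempty → (cornerAvoiders P Q L H).card = ballot (s + 1) (Q.card + L.card) := by
      intro P Q L H hPQ hLH hc hs hL
      have hLc := Finset.card_pos.2 hL
      rcases P.eq_empty_or_nonempty with rfl | hP
      · rw [cornerAvoiders_empty_left hL.choose_spec, Finset.card_empty, ballot_eq_zero_of_lt]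
        simp at hs hc
        omega
      · obtain ⟨P, q, hlt, rfl⟩ : ∃ P' q, (∀ p ∈ P', p < q) ∧ P = insert q P' :=
          ⟨P.erase (P.max' hP), P.max' hP, fun p hp => P.lt_max'_of_mem_erase_max' hP hp,
            (Finset.insert_erase (P.max'_mem hP)).symm⟩
        obtain ⟨L, l, hgt, rfl⟩ : ∃ L' l, (∀ y ∈ L', l < y) ∧ L = insert l L' :=
          ⟨L.erase (L.min' hL), L.min' hL, fun p hp => L.min'_lt_of_mem_erase_min' hL hp,
            (Finset.insert_erase (L.min'_mem hL)).symm⟩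
        have hqP : q ∉ P := fun h => lt_irrefl _ (hlt q h)
        have hlL : l ∉ L := fun h => lt_irrefl _ (hgt l h)
        have hqQ : q ∉ Q := fun h => lt_irrefl _ (hPQ q (by simp) q h)
        rw [Finset.card_insert_of_notMem hqP, Finset.card_insert_of_notMem hlL] at hc
        rw [Finset.card_insert_of_notMem hqP] at hs
        -- Both cases lower |P| + |H| by one. Deleting (q, l) lowers |Q| + |L| by one and moving q
        -- raises it by one: these are the two possible last steps of a path.
        rw [card_cornerAvoiders_insert hlt (hPQ q (by simp)) hgt (hLH l (by simp)),
          ih P Q L H (fun x hx => hPQ x (by simp [hx])) (fun x hx => hLH x (by simp [hx]))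
            (by omega) (by omega),
          ih P (insert q Q) (insert l L) H ?_ hLH ?_ (by omega),
          Finset.card_insert_of_notMem hqQ, Finset.card_insert_of_notMem hlL]
        · rw [← add_assoc Q.card L.card 1, ballot_succ_succ]
          congr 2; omega
        · intro x hx y hy
          rcases Finset.mem_insert.1 hy with rfl | hy
          · exact hlt x hx
          · exact hPQ x (by simp [hx]) y hy
        · rw [Finset.card_insert_of_notMem hqQ, Finset.card_insert_of_notMem hlL]; omega
    intro P Q L H hPQ hLH hc hs
    rcases L.eq_empty_or_nonempty with rfl | hL
    · rcases Q.eq_empty_or_nonempty with rfl | ⟨q, hq⟩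
      · have hP : P.Nonempty := Finset.card_pos.1 (by simp at hc; omega)
        obtain ⟨P, q, hlt, rfl⟩ : ∃ P' q, (∀ p ∈ P', p < q) ∧ P = insert q P' :=
          ⟨P.erase (P.max' hP), P.max' hP, fun p hp => P.lt_max'_of_mem_erase_max' hP hp,
            (Finset.insert_erase (P.max'_mem hP)).symm⟩
        have hqP : q ∉ P := fun h => lt_irrefl _ (hlt q h)
        rw [Finset.card_insert_of_notMem hqP] at hc hs
        rw [cornerAvoiders_singleton_right, ih P {q} ∅ H (by simpa using hlt) (by simp)
          (by simpa using hc) (by omega)]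
        simp [ballot_succ_zero]
      -- Here L is empty and Q is not; after the reflection the image of Q plays the part of L, so
      -- `key` applies.
      · rw [← card_cornerAvoiders_negSet, key, card_negSet, card_negSet, add_comm (Finset.card ∅)]
        · intro x hx y hy
          have := hLH (-y) (mem_negSet.1 hy) (-x) (mem_negSet.1 hx)
          omega
        · intro x hx y hy
          have := hPQ (-y) (mem_negSet.1 hy) (-x) (mem_negSet.1 hx)
          omega
        · simp only [card_negSet]; omega
        · simp only [card_negSet]; omega
        · exact ⟨-q, mem_negSet.2 (by rwa [neg_neg])⟩
    · exact key P Q L H hPQ hLH hc hs hL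

/-! ### Restricting and uniting graphs of bijections. -/

section Glue

variable {I J I₁ J₁ I₂ J₂ : Finset ℤ} {S E F : Finset (ℤ × ℤ)}

theorem IsBijGraph.card_eq (h : IsBijGraph I J S) : I.card = J.card := by
  refine Finset.card_bij' (fun x hx => (h.exists_snd hx).choose)
    (fun y hy => (h.exists_fst hy).choose) ?_ ?_ ?_ ?_
  · exact fun x hx => h.snd_mem (h.exists_snd hx).choose_spec
  · exact fun y hy => h.fst_mem (h.exists_fst hy).choose_spec
  · exact fun x hx => h.fst_unique
      (h.exists_fst (h.snd_mem (h.exists_snd hx).choose_spec)).choose_spec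
      (h.exists_snd hx).choose_spec
  · exact fun y hy => h.snd_unique
      (h.exists_snd (h.fst_mem (h.exists_fst hy).choose_spec)).choose_spec
      (h.exists_fst hy).choose_spec

theorem IsBijGraph.filter (h : IsBijGraph I J S) (hI : I₁ ⊆ I) (hJ : J₁ ⊆ J)
    (hiff : ∀ {x y}, (x, y) ∈ S → (x ∈ I₁ ↔ y ∈ J₁)) :
    IsBijGraph I₁ J₁ (S.filter fun p => p.1 ∈ I₁) where
  fst_mem hxy := (Finset.mem_filter.1 hxy).2
  snd_mem hxy := (hiff (Finset.mem_filter.1 hxy).1).1 (Finset.mem_filter.1 hxy).2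
  exists_snd hx := by
    obtain ⟨y, hy⟩ := h.exists_snd (hI hx)
    exact ⟨y, Finset.mem_filter.2 ⟨hy, hx⟩⟩
  exists_fst hy := by
    obtain ⟨x, hx⟩ := h.exists_fst (hJ hy)
    exact ⟨x, Finset.mem_filter.2 ⟨hx, (hiff hx).2 hy⟩⟩
  snd_unique h1 h2 := h.snd_unique (Finset.mem_filter.1 h1).1 (Finset.mem_filter.1 h2).1
  fst_unique h1 h2 := h.fst_unique (Finset.mem_filter.1 h1).1 (Finset.mem_filter.1 h2).1

theorem IsBijGraph.union (h₁ : IsBijGraph I₁ J₁ E) (h₂ : IsBijGraph I₂ J₂ F)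
    (hI : Disjoint I₁ I₂) (hJ : Disjoint J₁ J₂) :
    IsBijGraph (I₁ ∪ I₂) (J₁ ∪ J₂) (E ∪ F) where
  fst_mem hxy := by
    rcases Finset.mem_union.1 hxy with h | h
    · exact Finset.mem_union_left _ (h₁.fst_mem h)
    · exact Finset.mem_union_right _ (h₂.fst_mem h)
  snd_mem hxy := by
    rcases Finset.mem_union.1 hxy with h | h
    · exact Finset.mem_union_left _ (h₁.snd_mem h)
    · exact Finset.mem_union_right _ (h₂.snd_mem h)
  exists_snd hx := by
    rcases Finset.mem_union.1 hx with h | h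
    · obtain ⟨y, hy⟩ := h₁.exists_snd h
      exact ⟨y, Finset.mem_union_left _ hy⟩
    · obtain ⟨y, hy⟩ := h₂.exists_snd h
      exact ⟨y, Finset.mem_union_right _ hy⟩
  exists_fst hx := by
    rcases Finset.mem_union.1 hx with h | h
    · obtain ⟨y, hy⟩ := h₁.exists_fst h
      exact ⟨y, Finset.mem_union_left _ hy⟩
    · obtain ⟨y, hy⟩ := h₂.exists_fst h
      exact ⟨y, Finset.mem_union_right _ hy⟩
  snd_unique h h' := by
    rcases Finset.mem_union.1 h with k | k <;> rcases Finset.mem_union.1 h' with k' | k'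
    · exact h₁.snd_unique k k'
    · exact absurd (h₂.fst_mem k') (Finset.disjoint_left.1 hI (h₁.fst_mem k))
    · exact absurd (h₂.fst_mem k) (Finset.disjoint_left.1 hI (h₁.fst_mem k'))
    · exact h₂.snd_unique k k'
  fst_unique h h' := by
    rcases Finset.mem_union.1 h with k | k <;> rcases Finset.mem_union.1 h' with k' | k'
    · exact h₁.fst_unique k k'
    · exact absurd (h₂.snd_mem k') (Finset.disjoint_left.1 hJ (h₁.snd_mem k))
    · exact absurd (h₂.snd_mem k) (Finset.disjoint_left.1 hJ (h₁.snd_mem k'))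
    · exact h₂.fst_unique k k'

theorem isBijGraph_singleton (x y : ℤ) : IsBijGraph {x} {y} {(x, y)} := by
  constructor <;> simp +contextual

theorem IsBijGraph.filter_union_left (h₁ : IsBijGraph I₁ J₁ E) (h₂ : IsBijGraph I₂ J₂ F)
    (hI : Disjoint I₁ I₂) : (E ∪ F).filter (fun p => p.1 ∈ I₁) = E := by
  ext ⟨x, y⟩
  simp only [Finset.mem_filter, Finset.mem_union]
  refine ⟨?_, fun h => ⟨Or.inl h, h₁.fst_mem h⟩⟩
  rintro ⟨h | h, hx⟩
  · exact h
  · exact absurd (h₂.fst_mem h) (Finset.disjoint_left.1 hI hx)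

theorem IsBijGraph.filter_union_filter (h : IsBijGraph I J S) (hI : I ⊆ I₁ ∪ I₂) :
    S.filter (fun p => p.1 ∈ I₁) ∪ S.filter (fun p => p.1 ∈ I₂) = S := by
  ext ⟨x, y⟩
  simp only [Finset.mem_filter, Finset.mem_union, ← and_or_left, and_iff_left_iff_imp]
  exact fun hxy => by simpa using hI (h.fst_mem hxy)

theorem Avoids123.mono (h : Avoids123 S) (hE : E ⊆ S) : Avoids123 E :=
  fun _ _ _ _ _ _ h1 h2 h3 => h (hE h1) (hE h2) (hE h3)

end Glue

theorem cornerAvoiders_eq_empty_of_card_ne {P Q L H : Finset ℤ} (hPQ : Disjoint P Q)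
    (hLH : Disjoint L H) (h : P.card + Q.card ≠ L.card + H.card) :
    cornerAvoiders P Q L H = ∅ := by
  refine Finset.eq_empty_of_forall_notMem fun S hS => h ?_
  rw [← Finset.card_union_of_disjoint hPQ, ← Finset.card_union_of_disjoint hLH]
  exact (mem_cornerAvoiders.1 hS).bij.card_eq

/-! ### The half-turn, for corners in the opposite orientation. -/

section Rotate

/-- The half-turn `(x, y) ↦ (-x, -y)` of a set of points. -/
def halfTurn (S : Finset (ℤ × ℤ)) : Finset (ℤ × ℤ) :=
  S.map ((Equiv.neg ℤ).prodCongr (Equiv.neg ℤ)).toEmbedding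

theorem mem_halfTurn {S : Finset (ℤ × ℤ)} {x y : ℤ} :
    (x, y) ∈ halfTurn S ↔ (-x, -y) ∈ S := by
  simp only [halfTurn, Finset.mem_map_equiv]
  rfl

theorem halfTurn_halfTurn (S : Finset (ℤ × ℤ)) : halfTurn (halfTurn S) = S := by
  ext ⟨x, y⟩; simp [mem_halfTurn]

variable {I J P Q L H : Finset ℤ} {S : Finset (ℤ × ℤ)}

theorem IsBijGraph.halfTurn (h : IsBijGraph I J S) :
    IsBijGraph (negSet I) (negSet J) (halfTurn S) where
  fst_mem hxy := mem_negSet.2 (h.fst_mem (mem_halfTurn.1 hxy))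
  snd_mem hxy := mem_negSet.2 (h.snd_mem (mem_halfTurn.1 hxy))
  exists_snd {x} hx := by
    obtain ⟨y, hy⟩ := h.exists_snd (mem_negSet.1 hx)
    exact ⟨-y, mem_halfTurn.2 (by rwa [neg_neg])⟩
  exists_fst {x} hx := by
    obtain ⟨y, hy⟩ := h.exists_fst (mem_negSet.1 hx)
    exact ⟨-y, mem_halfTurn.2 (by rwa [neg_neg])⟩
  snd_unique h1 h2 :=
    neg_injective (h.snd_unique (mem_halfTurn.1 h1) (mem_halfTurn.1 h2))
  fst_unique h1 h2 :=
    neg_injective (h.fst_unique (mem_halfTurn.1 h1) (mem_halfTurn.1 h2))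

theorem Avoids123.halfTurn (h : Avoids123 S) : Avoids123 (halfTurn S) :=
  fun _ _ _ _ _ _ h1 h2 h3 a b c d =>
    h (mem_halfTurn.1 h3) (mem_halfTurn.1 h2) (mem_halfTurn.1 h1)
      (neg_lt_neg b) (neg_lt_neg a) (neg_lt_neg d) (neg_lt_neg c)

theorem IsCornerAvoider.halfTurn (h : IsCornerAvoider P Q L H S) :
    IsCornerAvoider (negSet P) (negSet Q) (negSet L) (negSet H) (halfTurn S) where
  bij := by
    have := h.bij.halfTurn
    rwa [negSet_union, negSet_union] at this
  avoids := h.avoids.halfTurn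
  corner hxy hx hy := h.corner (mem_halfTurn.1 hxy) (mem_negSet.1 hx) (mem_negSet.1 hy)
  anti_fst h1 h2 h3 h4 hlt := neg_lt_neg_iff.1 (h.anti_fst (mem_halfTurn.1 h2)
    (mem_halfTurn.1 h1) (mem_negSet.1 h4) (mem_negSet.1 h3) (neg_lt_neg hlt))
  anti_snd h1 h2 h3 h4 hlt := neg_lt_neg_iff.1 (h.anti_snd (mem_halfTurn.1 h2)
    (mem_halfTurn.1 h1) (mem_negSet.1 h4) (mem_negSet.1 h3) (neg_lt_neg hlt))

theorem card_cornerAvoiders_of_gt {s : ℕ} (hPQ : ∀ x ∈ P, ∀ y ∈ Q, y < x)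
    (hLH : ∀ x ∈ L, ∀ y ∈ H, y < x) (hc : P.card + Q.card = L.card + H.card)
    (hs : P.card + H.card = s) :
    (cornerAvoiders P Q L H).card = ballot s (Q.card + L.card) := by
  rw [← card_negSet Q, ← card_negSet L,
    ← card_cornerAvoiders s (negSet P) (negSet Q) (negSet L) (negSet H)]
  · refine Finset.card_nbij' _root_.halfTurn _root_.halfTurn ?_ ?_ ?_ ?_
    · exact fun S hS => mem_cornerAvoiders.2 (mem_cornerAvoiders.1 hS).halfTurn
    · intro S hS
      have := (mem_cornerAvoiders.1 hS).halfTurn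
      simp only [negSet_negSet] at this
      exact mem_cornerAvoiders.2 this
    · exact fun S _ => halfTurn_halfTurn S
    · exact fun S _ => halfTurn_halfTurn S
  · intro x hx y hy
    have := hPQ _ (mem_negSet.1 hx) _ (mem_negSet.1 hy)
    omega
  · intro x hx y hy
    have := hLH _ (mem_negSet.1 hx) _ (mem_negSet.1 hy)
    omega
  · simpa only [card_negSet] using hc
  · simpa only [card_negSet] using hs

end Rotate

/-! ### Avoiders with two prescribed fixed points. -/

section TwoFixed

/-- `S` is the graph of a `123`-avoiding permutation of `I`. -/
def IsAvoider (I : Finset ℤ) (S : Finset (ℤ × ℤ)) : Prop := IsBijGraph I I S ∧ Avoids123 S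

/-- The graphs of the `123`-avoiding permutations of `I`. -/
noncomputable def avoiders (I : Finset ℤ) : Finset (Finset (ℤ × ℤ)) :=
  letI := Classical.decPred (IsAvoider I)
  (I ×ˢ I).powerset.filter (IsAvoider I)

theorem mem_avoiders {I : Finset ℤ} {S : Finset (ℤ × ℤ)} :
    S ∈ avoiders I ↔ IsAvoider I S := by
  classical
  rw [avoiders, Finset.mem_filter, Finset.mem_powerset, and_iff_right_iff_imp]
  rintro h ⟨x, y⟩ hxy
  exact Finset.mem_product.2 ⟨h.1.fst_mem hxy, h.1.snd_mem hxy⟩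

theorem card_avoiders (I : Finset ℤ) : (avoiders I).card = ballot (2 * I.card) 0 := by
  have h : avoiders I = cornerAvoiders I ∅ ∅ I := by
    ext S
    rw [mem_avoiders, mem_cornerAvoiders]
    refine ⟨fun h => ⟨by simpa using h.1, h.2, by simp, by simp, by simp⟩,
      fun h => ⟨by simpa using h.bij, h.avoids⟩⟩
  rw [h, card_cornerAvoiders (2 * I.card) I ∅ ∅ I (by simp) (by simp) (by simp) (by omega)]
  simp

/-- A triple inside one piece is excluded by the avoidance of that piece. Every other triple
contradicts the regions allowed by `bE` and `bF`, or one of the four monotonicity conditions on the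
middle rows and columns. -/
theorem avoids123_glue {E F : Finset (ℤ × ℤ)} {i j : ℤ} (hij : i < j)
    (hE : Avoids123 E) (hF : Avoids123 F)
    (bE : ∀ {x y}, (x, y) ∈ E → (x < i ∧ i < y ∧ y ≠ j) ∨ (i < x ∧ x < j ∧ j < y))
    (bF : ∀ {x y}, (x, y) ∈ F → (i < x ∧ x < j ∧ y < i) ∨ (j < x ∧ y < j ∧ y ≠ i))
    (e1 : ∀ {x y x' y'}, (x, y) ∈ E → (x', y') ∈ E → i < x → i < x' → x < x' → y' < y)
    (e2 : ∀ {x y x' y'}, (x, y) ∈ E → (x', y') ∈ E → y < j → y' < j → x < x' → y' < y)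
    (f1 : ∀ {x y x' y'}, (x, y) ∈ F → (x', y') ∈ F → x < j → x' < j → x < x' → y' < y)
    (f2 : ∀ {x y x' y'}, (x, y) ∈ F → (x', y') ∈ F → i < y → i < y' → x < x' → y' < y) :
    Avoids123 (insert (i, i) (insert (j, j) (E ∪ F))) := by
  have hm : ∀ {x y}, (x, y) ∈ insert (i, i) (insert (j, j) (E ∪ F)) →
      (x = i ∧ y = i) ∨ (x = j ∧ y = j) ∨ (x, y) ∈ E ∨ (x, y) ∈ F := by simp
  intro x₁ y₁ x₂ y₂ x₃ y₃ h1 h2 h3 a b c d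
  rcases hm h1 with k1 | k1 | k1 | k1 <;> rcases hm h2 with k2 | k2 | k2 | k2 <;>
    rcases hm h3 with k3 | k3 | k3 | k3 <;>
    (try have b1 := bE k1) <;> (try have b2 := bE k2) <;> (try have b3 := bE k3) <;>
    (try have b1 := bF k1) <;> (try have b2 := bF k2) <;> (try have b3 := bF k3) <;>
    (try have g1 := e1 k1 k2) <;> (try have g2 := e2 k1 k2) <;>
    (try have g3 := e1 k2 k3) <;> (try have g4 := e2 k2 k3) <;>
    (try have g1 := f1 k1 k2) <;> (try have g2 := f2 k1 k2) <;>
    (try have g3 := f1 k2 k3) <;> (try have g4 := f2 k2 k3) <;>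
    first
    | omega
    | exact hE k1 k2 k3 a b c d
    | exact hF k1 k2 k3 a b c d

variable {I X Z : Finset ℤ} {i j : ℤ} {S E F : Finset (ℤ × ℤ)}

/-- The elements of `I` below `i`. -/
def below (I : Finset ℤ) (i : ℤ) : Finset ℤ := I.filter fun x => x < i

/-- The elements of `I` above `i`. -/
def above (I : Finset ℤ) (i : ℤ) : Finset ℤ := I.filter fun x => i < x

/-- The elements of `I` strictly between `i` and `j`. -/
def between (I : Finset ℤ) (i j : ℤ) : Finset ℤ := I.filter fun x => i < x ∧ x < j

theorem mem_below {x : ℤ} : x ∈ below I i ↔ x ∈ I ∧ x < i := Finset.mem_filter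

theorem mem_above {x : ℤ} : x ∈ above I i ↔ x ∈ I ∧ i < x := Finset.mem_filter

theorem mem_between {x : ℤ} : x ∈ between I i j ↔ x ∈ I ∧ i < x ∧ x < j := Finset.mem_filter

/-- The positions between `i` and `j` that `S` sends above `j`. -/
def positionsUp (I : Finset ℤ) (i j : ℤ) (S : Finset (ℤ × ℤ)) : Finset ℤ :=
  (between I i j).filter fun x => ∃ y ∈ above I j, (x, y) ∈ S

/-- The values between `i` and `j` that `S` takes below `i`. -/
def valuesLeft (I : Finset ℤ) (i j : ℤ) (S : Finset (ℤ × ℤ)) : Finset ℤ :=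
  (between I i j).filter fun y => ∃ x ∈ below I i, (x, y) ∈ S

theorem mem_positionsUp {x : ℤ} : x ∈ positionsUp I i j S ↔
    x ∈ between I i j ∧ ∃ y ∈ above I j, (x, y) ∈ S := Finset.mem_filter

theorem mem_valuesLeft {y : ℤ} : y ∈ valuesLeft I i j S ↔
    y ∈ between I i j ∧ ∃ x ∈ below I i, (x, y) ∈ S := Finset.mem_filter

/-- Each excluded region would complete a 123 with (i, i) and (j, j): below both, between both, or
above both. -/
theorem IsAvoider.block (h : IsAvoider I S) (hij : i < j) (hi : (i, i) ∈ S) (hj : (j, j) ∈ S)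
    {x y : ℤ} (hxy : (x, y) ∈ S) :
    (x = i ∧ y = i) ∨ (x = j ∧ y = j) ∨
      (x < i ∧ i < y ∧ y ≠ j) ∨ (i < x ∧ x < j ∧ (y < i ∨ j < y)) ∨ (j < x ∧ y < j ∧ y ≠ i) := by
  by_cases h1 : x = i
  · subst h1; exact Or.inl ⟨rfl, h.1.snd_unique hxy hi⟩
  by_cases h2 : x = j
  · subst h2; exact Or.inr (Or.inl ⟨rfl, h.1.snd_unique hxy hj⟩)
  have h3 : y ≠ i := by rintro rfl; exact h1 (h.1.fst_unique hxy hi)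
  have h4 : y ≠ j := by rintro rfl; exact h2 (h.1.fst_unique hxy hj)
  have g1 : ¬ (x < i ∧ y < i) := fun k => h.2 hxy hi hj k.1 hij k.2 hij
  have g2 : ¬ ((i < x ∧ x < j) ∧ (i < y ∧ y < j)) :=
    fun k => h.2 hi hxy hj k.1.1 k.1.2 k.2.1 k.2.2
  have g3 : ¬ (j < x ∧ j < y) := fun k => h.2 hi hj hxy hij k.1 hij k.2
  omega

theorem IsAvoider.mem_positionsUp_iff (h : IsAvoider I S) {x y : ℤ} (hxy : (x, y) ∈ S) :
    x ∈ positionsUp I i j S ↔ (i < x ∧ x < j) ∧ j < y := by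
  rw [mem_positionsUp, mem_between]
  constructor
  · rintro ⟨h1, y', hy', hxy'⟩
    rw [h.1.snd_unique hxy hxy']
    exact ⟨h1.2, (mem_above.1 hy').2⟩
  · rintro ⟨h1, h2⟩
    exact ⟨⟨h.1.fst_mem hxy, h1⟩, y, mem_above.2 ⟨h.1.snd_mem hxy, h2⟩, hxy⟩

theorem IsAvoider.mem_valuesLeft_iff (h : IsAvoider I S) {x y : ℤ} (hxy : (x, y) ∈ S) :
    y ∈ valuesLeft I i j S ↔ (i < y ∧ y < j) ∧ x < i := by
  rw [mem_valuesLeft, mem_between]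
  constructor
  · rintro ⟨h1, x', hx', hxy'⟩
    rw [h.1.fst_unique hxy hxy']
    exact ⟨h1.2, (mem_below.1 hx').2⟩
  · rintro ⟨h1, h2⟩
    exact ⟨⟨h.1.snd_mem hxy, h1⟩, x, mem_below.2 ⟨h.1.fst_mem hxy, h2⟩, hxy⟩

/-- The monotonicity comes from the fixed points: an ascent in the columns of `positionsUp` would be
preceded by (i, i), and an ascent in the rows of `valuesLeft` would be followed by (j, j). -/
theorem IsAvoider.upper (h : IsAvoider I S) (hij : i < j) (hi : (i, i) ∈ S) (hj : (j, j) ∈ S) :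
    IsCornerAvoider (below I i) (positionsUp I i j S) (valuesLeft I i j S) (above I j)
      (S.filter fun p => p.1 ∈ below I i ∪ positionsUp I i j S) := by
  have hb : ∀ {x y}, (x, y) ∈ S → _ := fun hxy => h.block hij hi hj hxy
  have hZ : ∀ {x y}, (x, y) ∈ S → _ := fun hxy => h.mem_positionsUp_iff (i := i) (j := j) hxy
  have hX : ∀ {x y}, (x, y) ∈ S → _ := fun hxy => h.mem_valuesLeft_iff (i := i) (j := j) hxy
  refine ⟨h.1.filter ?_ ?_ ?_, h.2.mono (Finset.filter_subset _ _), ?_, ?_, ?_⟩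
  · intro x hx
    rw [Finset.mem_union, mem_below, mem_positionsUp, mem_between] at hx
    tauto
  · intro x hx
    rw [Finset.mem_union, mem_above, mem_valuesLeft, mem_between] at hx
    tauto
  · intro x y hxy
    rw [Finset.mem_union, Finset.mem_union, hZ hxy, hX hxy, mem_below, mem_above]
    have := hb hxy
    have h1 := h.1.fst_mem hxy
    have h2 := h.1.snd_mem hxy
    simp only [h1, h2, true_and]
    omega
  · intro x y hxy hx hy
    have hxy := (Finset.mem_filter.1 hxy).1
    rw [hZ hxy] at hx
    rw [hX hxy] at hy
    omega
  · intro x y x' y' hxy hxy' hx hx' hlt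
    have hxy := (Finset.mem_filter.1 hxy).1
    have hxy' := (Finset.mem_filter.1 hxy').1
    rw [hZ hxy] at hx
    rw [hZ hxy'] at hx'
    by_contra! hy
    rcases hy.lt_or_eq with hy | rfl
    · exact h.2 hi hxy hxy' hx.1.1 hlt (by omega) hy
    · exact hlt.ne (h.1.fst_unique hxy hxy')
  · intro x y x' y' hxy hxy' hx hx' hlt
    have hxy := (Finset.mem_filter.1 hxy).1
    have hxy' := (Finset.mem_filter.1 hxy').1
    rw [hX hxy] at hx
    rw [hX hxy'] at hx'
    by_contra! hy
    rcases hy.lt_or_eq with hy | rfl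
    · exact h.2 hxy hxy' hj hlt (by omega) hy hx'.1.2
    · exact hlt.ne (h.1.fst_unique hxy hxy')

theorem IsAvoider.lower (h : IsAvoider I S) (hij : i < j) (hi : (i, i) ∈ S) (hj : (j, j) ∈ S) :
    IsCornerAvoider (above I j) (between I i j \ positionsUp I i j S)
      (between I i j \ valuesLeft I i j S) (below I i)
      (S.filter fun p => p.1 ∈ above I j ∪ (between I i j \ positionsUp I i j S)) := by
  have hb : ∀ {x y}, (x, y) ∈ S → _ := fun hxy => h.block hij hi hj hxy
  have hZ : ∀ {x y}, (x, y) ∈ S →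
      (x ∈ between I i j \ positionsUp I i j S ↔ (i < x ∧ x < j) ∧ ¬ j < y) := by
    intro x y hxy
    rw [Finset.mem_sdiff, h.mem_positionsUp_iff hxy, mem_between]
    have := h.1.fst_mem hxy
    tauto
  have hX : ∀ {x y}, (x, y) ∈ S →
      (y ∈ between I i j \ valuesLeft I i j S ↔ (i < y ∧ y < j) ∧ ¬ x < i) := by
    intro x y hxy
    rw [Finset.mem_sdiff, h.mem_valuesLeft_iff hxy, mem_between]
    have := h.1.snd_mem hxy
    tauto
  refine ⟨h.1.filter ?_ ?_ ?_, h.2.mono (Finset.filter_subset _ _), ?_, ?_, ?_⟩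
  · intro x hx
    rw [Finset.mem_union, mem_above, Finset.mem_sdiff, mem_between] at hx
    tauto
  · intro x hx
    rw [Finset.mem_union, mem_below, Finset.mem_sdiff, mem_between] at hx
    tauto
  · intro x y hxy
    rw [Finset.mem_union, Finset.mem_union, hZ hxy, hX hxy, mem_below, mem_above]
    have := hb hxy
    have h1 := h.1.fst_mem hxy
    have h2 := h.1.snd_mem hxy
    simp only [h1, h2, true_and]
    omega
  · intro x y hxy hx hy
    have hxy := (Finset.mem_filter.1 hxy).1
    have := hb hxy
    rw [hZ hxy] at hx
    rw [hX hxy] at hy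
    omega
  · intro x y x' y' hxy hxy' hx hx' hlt
    have hxy := (Finset.mem_filter.1 hxy).1
    have hxy' := (Finset.mem_filter.1 hxy').1
    have b1 := hb hxy'
    rw [hZ hxy] at hx
    rw [hZ hxy'] at hx'
    by_contra! hy
    rcases hy.lt_or_eq with hy | rfl
    · exact h.2 hxy hxy' hj hlt (by omega) hy (by omega)
    · exact hlt.ne (h.1.fst_unique hxy hxy')
  · intro x y x' y' hxy hxy' hx hx' hlt
    have hxy := (Finset.mem_filter.1 hxy).1
    have hxy' := (Finset.mem_filter.1 hxy').1
    have b1 := hb hxy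
    rw [hX hxy] at hx
    rw [hX hxy'] at hx'
    by_contra! hy
    rcases hy.lt_or_eq with hy | rfl
    · exact h.2 hi hxy hxy' (by omega) hlt (by omega) hy
    · exact hlt.ne (h.1.fst_unique hxy hxy')

/-- The set of points glued from the two pieces and the two fixed points. -/
def gluePoints (i j : ℤ) (E F : Finset (ℤ × ℤ)) : Finset (ℤ × ℤ) :=
  insert (i, i) (insert (j, j) (E ∪ F))

theorem mem_gluePoints {x y : ℤ} : (x, y) ∈ gluePoints i j E F ↔
    (x = i ∧ y = i) ∨ (x = j ∧ y = j) ∨ (x, y) ∈ E ∨ (x, y) ∈ F := by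
  simp [gluePoints]

theorem IsCornerAvoider.upper_block (hX : X ⊆ between I i j) (hZ : Z ⊆ between I i j)
    (hE : IsCornerAvoider (below I i) Z X (above I j) E) {x y : ℤ} (hxy : (x, y) ∈ E) :
    (x ∈ below I i ∧ y ∈ X ∧ x < i ∧ i < y ∧ y < j) ∨
    (x ∈ below I i ∧ y ∈ above I j ∧ x < i ∧ j < y) ∨
    (x ∈ Z ∧ y ∈ above I j ∧ i < x ∧ x < j ∧ j < y) := by
  rcases Finset.mem_union.1 (hE.bij.fst_mem hxy) with h1 | h1 <;>
    rcases Finset.mem_union.1 (hE.bij.snd_mem hxy) with h2 | h2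
  · exact Or.inl ⟨h1, h2, (mem_below.1 h1).2, (mem_between.1 (hX h2)).2⟩
  · exact Or.inr (Or.inl ⟨h1, h2, (mem_below.1 h1).2, (mem_above.1 h2).2⟩)
  · exact absurd h2 (hE.corner hxy h1)
  · obtain ⟨_, k1, k2⟩ := mem_between.1 (hZ h1)
    exact Or.inr (Or.inr ⟨h1, h2, k1, k2, (mem_above.1 h2).2⟩)

theorem IsCornerAvoider.lower_block (hX : X ⊆ between I i j) (hZ : Z ⊆ between I i j)
    (hF : IsCornerAvoider (above I j) Z X (below I i) F) {x y : ℤ} (hxy : (x, y) ∈ F) :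
    (x ∈ above I j ∧ y ∈ X ∧ j < x ∧ i < y ∧ y < j) ∨
    (x ∈ above I j ∧ y ∈ below I i ∧ j < x ∧ y < i) ∨
    (x ∈ Z ∧ y ∈ below I i ∧ i < x ∧ x < j ∧ y < i) := by
  rcases Finset.mem_union.1 (hF.bij.fst_mem hxy) with h1 | h1 <;>
    rcases Finset.mem_union.1 (hF.bij.snd_mem hxy) with h2 | h2
  · exact Or.inl ⟨h1, h2, (mem_above.1 h1).2, (mem_between.1 (hX h2)).2⟩
  · exact Or.inr (Or.inl ⟨h1, h2, (mem_above.1 h1).2, (mem_below.1 h2).2⟩)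
  · exact absurd h2 (hF.corner hxy h1)
  · obtain ⟨_, k1, k2⟩ := mem_between.1 (hZ h1)
    exact Or.inr (Or.inr ⟨h1, h2, k1, k2, (mem_below.1 h2).2⟩)

theorem disjoint_upper_lower (hij : i < j) (hZ : Z ⊆ between I i j) :
    Disjoint (below I i ∪ Z) (above I j ∪ (between I i j \ Z)) := by
  rw [Finset.disjoint_left]
  intro x hx hx'
  rw [Finset.mem_union, mem_below] at hx
  rw [Finset.mem_union, mem_above, Finset.mem_sdiff, mem_between] at hx'
  have := fun h => mem_between.1 (@hZ x h)
  grind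

theorem singleton_union_upper_lower (hi : i ∈ I) (hj : j ∈ I)
    (hZ : Z ⊆ between I i j) :
    {i} ∪ ({j} ∪ ((below I i ∪ Z) ∪ (above I j ∪ (between I i j \ Z)))) = I := by
  ext x
  simp only [Finset.mem_union, Finset.mem_singleton, mem_below, mem_above, Finset.mem_sdiff]
  have := fun h => mem_between.1 (@hZ x h)
  rw [mem_between]
  grind

theorem isAvoider_gluePoints (hij : i < j) (hi : i ∈ I) (hj : j ∈ I)
    (hX : X ⊆ between I i j) (hZ : Z ⊆ between I i j)
    (hE : IsCornerAvoider (below I i) Z X (above I j) E)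
    (hF : IsCornerAvoider (above I j) (between I i j \ Z) (between I i j \ X) (below I i) F) :
    IsAvoider I (gluePoints i j E F) := by
  have bE : ∀ {x y}, (x, y) ∈ E → _ := fun hxy => hE.upper_block hX hZ hxy
  have bF : ∀ {x y}, (x, y) ∈ F → _ :=
    fun hxy => hF.lower_block Finset.sdiff_subset Finset.sdiff_subset hxy
  constructor
  · have hrw : ∀ W : Finset ℤ, (W ∪ above I j) ∪ ((between I i j \ W) ∪ below I i)
        = (below I i ∪ W) ∪ (above I j ∪ (between I i j \ W)) := by
      intro W
      ext x
      simp only [Finset.mem_union]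
      tauto
    have hd : Disjoint (X ∪ above I j) ((between I i j \ X) ∪ below I i) := by
      rw [Finset.disjoint_left]
      intro x hx hx'
      rw [Finset.mem_union, mem_above] at hx
      rw [Finset.mem_union, mem_below, Finset.mem_sdiff, mem_between] at hx'
      have := fun h => mem_between.1 (@hX x h)
      grind
    have hj1 : ∀ W ⊆ between I i j,
        Disjoint {j} ((below I i ∪ W) ∪ (above I j ∪ (between I i j \ W))) := by
      intro W hW
      have := fun h => mem_between.1 (@hW j h)
      simp only [Finset.disjoint_singleton_left, Finset.mem_union, mem_below, mem_above,
        Finset.mem_sdiff, mem_between]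
      grind
    have hi1 : ∀ W ⊆ between I i j,
        Disjoint {i} ({j} ∪ ((below I i ∪ W) ∪ (above I j ∪ (between I i j \ W)))) := by
      intro W hW
      have := fun h => mem_between.1 (@hW i h)
      simp only [Finset.disjoint_singleton_left, Finset.mem_union, mem_below, mem_above,
        Finset.mem_sdiff, mem_between, Finset.mem_singleton]
      grind
    have := (isBijGraph_singleton i i).union ((isBijGraph_singleton j j).union
      (hE.bij.union hF.bij (disjoint_upper_lower hij hZ) hd) (hj1 Z hZ)
      (by rw [hrw]; exact hj1 X hX)) (hi1 Z hZ) (by rw [hrw]; exact hi1 X hX)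
    rwa [hrw, singleton_union_upper_lower hi hj hZ, singleton_union_upper_lower hi hj hX] at this
  · refine avoids123_glue hij hE.avoids hF.avoids ?_ ?_ ?_ ?_ ?_ ?_
    · intro x y hxy
      have := bE hxy
      omega
    · intro x y hxy
      have := bF hxy
      omega
    · intro x y x' y' h1 h2 k1 k2
      have := bE h1
      have := bE h2
      exact hE.anti_fst h1 h2 (by grind) (by grind)
    · intro x y x' y' h1 h2 k1 k2
      have := bE h1
      have := bE h2
      exact hE.anti_snd h1 h2 (by grind) (by grind)
    · intro x y x' y' h1 h2 k1 k2
      have := bF h1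
      have := bF h2
      exact hF.anti_fst h1 h2 (by grind) (by grind)
    · intro x y x' y' h1 h2 k1 k2
      have := bF h1
      have := bF h2
      exact hF.anti_snd h1 h2 (by grind) (by grind)

theorem positionsUp_gluePoints (hX : X ⊆ between I i j) (hZ : Z ⊆ between I i j)
    (hE : IsCornerAvoider (below I i) Z X (above I j) E)
    (hF : IsCornerAvoider (above I j) (between I i j \ Z) (between I i j \ X) (below I i) F) :
    positionsUp I i j (gluePoints i j E F) = Z := by
  ext x
  rw [mem_positionsUp]
  constructor
  · rintro ⟨h1, y, hy, hxy⟩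
    rw [mem_between] at h1
    rw [mem_above] at hy
    rcases mem_gluePoints.1 hxy with h | h | h | h
    · omega
    · omega
    · have := hE.upper_block hX hZ h
      grind
    · have := hF.lower_block Finset.sdiff_subset Finset.sdiff_subset h
      omega
  · intro hx
    refine ⟨hZ hx, ?_⟩
    obtain ⟨y, hy⟩ := hE.bij.exists_snd (Finset.mem_union_right _ hx)
    refine ⟨y, ?_, mem_gluePoints.2 (by tauto)⟩
    have h1 := hE.upper_block hX hZ hy
    have h2 := mem_between.1 (hZ hx)
    grind

theorem valuesLeft_gluePoints (hij : i < j) (hX : X ⊆ between I i j) (hZ : Z ⊆ between I i j)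
    (hE : IsCornerAvoider (below I i) Z X (above I j) E)
    (hF : IsCornerAvoider (above I j) (between I i j \ Z) (between I i j \ X) (below I i) F) :
    valuesLeft I i j (gluePoints i j E F) = X := by
  ext y
  rw [mem_valuesLeft]
  constructor
  · rintro ⟨h1, x, hx, hxy⟩
    rw [mem_between] at h1
    rw [mem_below] at hx
    rcases mem_gluePoints.1 hxy with h | h | h | h
    · omega
    · omega
    · have := hE.upper_block hX hZ h
      grind
    · have := hF.lower_block Finset.sdiff_subset Finset.sdiff_subset h
      omega
  · intro hy
    refine ⟨hX hy, ?_⟩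
    obtain ⟨x, hx⟩ := hE.bij.exists_fst (Finset.mem_union_left _ hy)
    refine ⟨x, ?_, mem_gluePoints.2 (by tauto)⟩
    have h1 := hE.upper_block hX hZ hx
    have h2 := mem_between.1 (hX hy)
    grind

theorem filter_gluePoints_upper (hij : i < j) (hZ : Z ⊆ between I i j)
    (hE : IsCornerAvoider (below I i) Z X (above I j) E)
    (hF : IsCornerAvoider (above I j) (between I i j \ Z) (between I i j \ X) (below I i) F) :
    (gluePoints i j E F).filter (fun p => p.1 ∈ below I i ∪ Z) = E := by
  rw [gluePoints, Finset.filter_insert, if_neg, Finset.filter_insert, if_neg,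
    hE.bij.filter_union_left hF.bij (disjoint_upper_lower hij hZ)]
  · have := fun h => mem_between.1 (@hZ j h)
    simp only [Finset.mem_union, mem_below]
    grind
  · have := fun h => mem_between.1 (@hZ i h)
    simp only [Finset.mem_union, mem_below]
    grind

theorem filter_gluePoints_lower (hij : i < j) (hZ : Z ⊆ between I i j)
    (hE : IsCornerAvoider (below I i) Z X (above I j) E)
    (hF : IsCornerAvoider (above I j) (between I i j \ Z) (between I i j \ X) (below I i) F) :
    (gluePoints i j E F).filter (fun p => p.1 ∈ above I j ∪ (between I i j \ Z)) = F := by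
  rw [gluePoints, Finset.filter_insert, if_neg, Finset.filter_insert, if_neg, Finset.union_comm E,
    hF.bij.filter_union_left hE.bij (disjoint_upper_lower hij hZ).symm]
  · simp only [Finset.mem_union, mem_above, Finset.mem_sdiff, mem_between]
    grind
  · simp only [Finset.mem_union, mem_above, Finset.mem_sdiff, mem_between]
    grind

theorem gluePoints_filter (h : IsAvoider I S) (hij : i < j) (hi : (i, i) ∈ S)
    (hj : (j, j) ∈ S) (hZ : Z ⊆ between I i j) :
    gluePoints i j (S.filter fun p => p.1 ∈ below I i ∪ Z)
      (S.filter fun p => p.1 ∈ above I j ∪ (between I i j \ Z)) = S := by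
  ext ⟨x, y⟩
  rw [mem_gluePoints, Finset.mem_filter, Finset.mem_filter]
  constructor
  · rintro (⟨rfl, rfl⟩ | ⟨rfl, rfl⟩ | h | h)
    exacts [hi, hj, h.1, h.1]
  · intro hxy
    have h1 := singleton_union_upper_lower (h.1.fst_mem hi) (h.1.fst_mem hj) hZ
    have h2 := h.1.fst_mem hxy
    have h3 := h.block hij hi hj hxy
    rw [← h1, Finset.mem_union, Finset.mem_union, Finset.mem_union, Finset.mem_singleton,
      Finset.mem_singleton] at h2
    have h4 : x = i → y = i := by omega
    have h5 : x = j → y = j := by omega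
    tauto

open scoped Classical in
/-- The number of avoiders with two given fixed points. -/
theorem card_avoiders_two_fixed (hij : i < j) (hi : i ∈ I) (hj : j ∈ I) :
    ((avoiders I).filter fun S => (i, i) ∈ S ∧ (j, j) ∈ S).card =
      ∑ W ∈ (between I i j).powerset ×ˢ (between I i j).powerset,
        (cornerAvoiders (below I i) W.2 W.1 (above I j)).card *
        (cornerAvoiders (above I j) (between I i j \ W.2) (between I i j \ W.1)
          (below I i)).card := by
  -- Once the middle values X and the middle positions Z of the upper piece are fixed, the lower
  -- piece uses their complements, and the two pieces can be chosen independently.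
  rw [Finset.card_eq_sum_card_fiberwise (f := fun S => (valuesLeft I i j S, positionsUp I i j S))
    (t := (between I i j).powerset ×ˢ (between I i j).powerset)]
  · refine Finset.sum_congr rfl ?_
    rintro ⟨X, Z⟩ hW
    rw [Finset.mem_product, Finset.mem_powerset, Finset.mem_powerset] at hW
    obtain ⟨hX, hZ⟩ := hW
    dsimp only at hX hZ ⊢
    rw [← Finset.card_product]
    refine Finset.card_nbij' (fun S => (S.filter fun p => p.1 ∈ below I i ∪ Z,
      S.filter fun p => p.1 ∈ above I j ∪ (between I i j \ Z)))
      (fun EF => gluePoints i j EF.1 EF.2) ?_ ?_ ?_ ?_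
    · intro S hS
      simp only [Finset.coe_filter, Finset.mem_filter, Set.mem_ofPred_eq, mem_avoiders,
        Prod.mk.injEq] at hS
      obtain ⟨⟨h, hi, hj⟩, rfl, rfl⟩ := hS
      simp only [Finset.mem_coe, Finset.mem_product, mem_cornerAvoiders]
      exact ⟨h.upper hij hi hj, h.lower hij hi hj⟩
    · rintro ⟨E, F⟩ hEF
      simp only [Finset.mem_coe, Finset.mem_product, mem_cornerAvoiders] at hEF
      simp only [Finset.coe_filter, Finset.mem_filter, Set.mem_ofPred_eq, mem_avoiders,
        Prod.mk.injEq]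
      exact ⟨⟨isAvoider_gluePoints hij hi hj hX hZ hEF.1 hEF.2, by simp [gluePoints],
        by simp [gluePoints]⟩, valuesLeft_gluePoints hij hX hZ hEF.1 hEF.2,
        positionsUp_gluePoints hX hZ hEF.1 hEF.2⟩
    · intro S hS
      simp only [Finset.coe_filter, Finset.mem_filter, Set.mem_ofPred_eq, mem_avoiders] at hS
      exact gluePoints_filter hS.1.1 hij hS.1.2.1 hS.1.2.2 hZ
    · rintro ⟨E, F⟩ hEF
      simp only [Finset.mem_coe, Finset.mem_product, mem_cornerAvoiders] at hEF
      exact Prod.ext (filter_gluePoints_upper hij hZ hEF.1 hEF.2)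
        (filter_gluePoints_lower hij hZ hEF.1 hEF.2)
  · intro S _
    simp only [Finset.mem_coe, Finset.mem_product, Finset.mem_powerset]
    exact ⟨Finset.filter_subset _ _, Finset.filter_subset _ _⟩

end TwoFixed

/-! ### Summing over the positions of the two fixed points. -/

/-- Vandermonde's identity, grouping the pairs by x + z. -/
theorem sum_choose_mul_choose (m : ℕ) (g : ℕ → ℕ) :
    ∑ x ∈ Finset.range (m + 1), ∑ z ∈ Finset.range (m + 1), m.choose x * m.choose z * g (x + z)
      = ∑ k ∈ Finset.range (2 * m + 1), (2 * m).choose k * g k := by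
  rw [← Finset.sum_product',
    ← Finset.sum_fiberwise_of_maps_to (t := Finset.range (2 * m + 1)) (g := fun p => p.1 + p.2)]
  · refine Finset.sum_congr rfl fun k _ => ?_
    rw [two_mul, Nat.add_choose_eq, Finset.sum_mul]
    refine Finset.sum_subset_zero_on_sdiff ?_ ?_ ?_
    · rintro ⟨x, z⟩ h
      simpa using (Finset.mem_filter.1 h).2
    · rintro ⟨x, z⟩ h
      rw [Finset.mem_sdiff, Finset.HasAntidiagonal.mem_antidiagonal, Finset.mem_filter,
        Finset.mem_product, Finset.mem_range, Finset.mem_range] at h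
      dsimp only at h ⊢
      rcases lt_or_ge m x with hx | hx
      · simp [Nat.choose_eq_zero_of_lt hx]
      · rw [Nat.choose_eq_zero_of_lt (show m < z by omega)]; simp
    · rintro ⟨x, z⟩ h
      have := (Finset.mem_filter.1 h).2
      dsimp only at this ⊢
      rw [this]
  · rintro ⟨x, z⟩ h
    simp only [Finset.mem_product, Finset.mem_range] at h ⊢
    omega

/-- The number of `123`-avoiding permutations with two given fixed points that have `a` points
below, `m` points between and `c` points above them. -/
def twoFixedCount (a m c : ℕ) : ℕ :=
  ∑ x ∈ Finset.range (m + 1), ∑ z ∈ Finset.range (m + 1), m.choose x * m.choose z *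
    (if a + z = x + c then ballot (a + c) (x + z) * ballot (a + c) (2 * m - (x + z)) else 0)

/-- The balance condition has at most the one solution a = (s + x - z) / 2. If this is not an
integer in the range, then `ballot s (x + z)` is already zero, by parity or because x + z > s. So
summing over a removes the indicator in `twoFixedCount`. -/
theorem ballot_mul_card_filter (s x z : ℕ) :
    ∑ a ∈ Finset.range (s + 1), (if a + z = x + (s - a) then ballot s (x + z) else 0)
      = ballot s (x + z) := by
  by_cases h : s < x + z
  · simp [ballot_eq_zero_of_lt h]
  by_cases ho : Odd (s + (x + z))
  · simp [ballot_eq_zero_of_odd ho]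
  obtain ⟨k, hk⟩ : ∃ k, s + x = 2 * k + z := by
    rw [Nat.not_odd_iff_even] at ho
    obtain ⟨k, hk⟩ := ho
    exact ⟨(s + x - z) / 2, by omega⟩
  rw [Finset.sum_eq_single k, if_pos (by omega)]
  · intro a ha hak
    rw [Finset.mem_range] at ha
    rw [if_neg (by omega)]
  · intro hk'
    rw [Finset.mem_range] at hk'
    omega

theorem sum_twoFixedCount (s m : ℕ) :
    ((∑ a ∈ Finset.range (s + 1), twoFixedCount a m (s - a) : ℕ) : ℤ) = ballotConv 0 s m := by
  have h : ∑ a ∈ Finset.range (s + 1), twoFixedCount a m (s - a)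
      = ∑ k ∈ Finset.range (2 * m + 1), (2 * m).choose k *
        (ballot s k * ballot s (2 * m - k)) := by
    rw [← sum_choose_mul_choose m fun k => ballot s k * ballot s (2 * m - k)]
    simp only [twoFixedCount]
    rw [Finset.sum_comm]
    refine Finset.sum_congr rfl fun x _ => ?_
    rw [Finset.sum_comm]
    refine Finset.sum_congr rfl fun z _ => ?_
    rw [← Finset.mul_sum, ← ballot_mul_card_filter s x z, Finset.sum_mul]
    congr 1
    refine Finset.sum_congr rfl fun a ha => ?_
    rw [Finset.mem_range] at ha
    rw [show a + (s - a) = s by omega, ite_mul, zero_mul]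
  rw [h, ballotConv, Finset.Nat.sum_antidiagonal_eq_sum_range_succ
    (fun i j => ((2 * m).choose i : ℤ) * ((ballot s (i + 0) : ℤ) * ballot s (j + 0)))]
  push_cast
  rfl

theorem sum_card_cornerAvoiders {I : Finset ℤ} {i j : ℤ} {a m c : ℕ}
    (ha : (below I i).card = a) (hm : (between I i j).card = m) (hc : (above I j).card = c) :
    ∑ W ∈ (between I i j).powerset ×ˢ (between I i j).powerset,
        (cornerAvoiders (below I i) W.2 W.1 (above I j)).card *
        (cornerAvoiders (above I j) (between I i j \ W.2) (between I i j \ W.1)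
          (below I i)).card = twoFixedCount a m c := by
  have hterm : ∀ X ∈ (between I i j).powerset, ∀ Z ∈ (between I i j).powerset,
      (cornerAvoiders (below I i) Z X (above I j)).card *
        (cornerAvoiders (above I j) (between I i j \ Z) (between I i j \ X) (below I i)).card
      = if a + Z.card = X.card + c then ballot (a + c) (X.card + Z.card) *
        ballot (a + c) (2 * m - (X.card + Z.card)) else 0 := by
    intro X hX Z hZ
    rw [Finset.mem_powerset] at hX hZ
    have b1 : ∀ W ⊆ between I i j, ∀ x ∈ below I i, ∀ y ∈ W, x < y := by
      intro W hW x hx y hy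
      have h1 := mem_below.1 hx
      have h2 := mem_between.1 (hW hy)
      omega
    have b2 : ∀ W ⊆ between I i j, ∀ x ∈ W, ∀ y ∈ above I j, x < y := by
      intro W hW x hx y hy
      have h1 := mem_above.1 hy
      have h2 := mem_between.1 (hW hx)
      omega
    have hXm := Finset.card_le_card hX
    have hZm := Finset.card_le_card hZ
    have hXc : (between I i j \ X).card = m - X.card := by
      rw [Finset.card_sdiff_of_subset hX, hm]
    have hZc : (between I i j \ Z).card = m - Z.card := by
      rw [Finset.card_sdiff_of_subset hZ, hm]
    rw [hm] at hXm hZm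
    split_ifs with hif
    · rw [card_cornerAvoiders (a + c) _ _ _ _ (b1 Z hZ) (b2 X hX) (by omega) (by omega),
        card_cornerAvoiders_of_gt (s := a + c)
          (fun x hx y hy => b2 _ Finset.sdiff_subset y hy x hx)
          (fun x hx y hy => b1 _ Finset.sdiff_subset y hy x hx) (by omega) (by omega),
        hXc, hZc, add_comm Z.card, show m - Z.card + (m - X.card) = 2 * m - (X.card + Z.card) by
          omega]
    · rw [cornerAvoiders_eq_empty_of_card_ne _ _ (by omega)]
      · simp
      · exact Finset.disjoint_left.2 fun x hx hx' => lt_irrefl _ (b1 Z hZ x hx x hx')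
      · exact Finset.disjoint_left.2 fun x hx hx' => lt_irrefl _ (b2 X hX x hx x hx')
  rw [Finset.sum_product]
  rw [Finset.sum_congr rfl fun X hX => Finset.sum_congr rfl fun Z hZ => hterm X hX Z hZ]
  rw [Finset.sum_congr rfl fun X _ => Finset.sum_powerset_apply_card (fun z =>
    if a + z = X.card + c then ballot (a + c) (X.card + z) *
        ballot (a + c) (2 * m - (X.card + z)) else 0),
    Finset.sum_powerset_apply_card (fun x => ∑ z ∈ Finset.range ((between I i j).card + 1),
      (between I i j).card.choose z • if a + z = x + c then ballot (a + c) (x + z) *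
        ballot (a + c) (2 * m - (x + z)) else 0), hm, twoFixedCount]
  refine Finset.sum_congr rfl fun x _ => ?_
  rw [Finset.smul_sum]
  refine Finset.sum_congr rfl fun z _ => ?_
  rw [smul_eq_mul, smul_eq_mul, mul_assoc]

/-- The integers `0, …, n - 1`. -/
noncomputable def intRange (n : ℕ) : Finset ℤ := Finset.Ico 0 (n : ℤ)

theorem mem_intRange {n : ℕ} {x : ℤ} : x ∈ intRange n ↔ 0 ≤ x ∧ x < n := Finset.mem_Ico

theorem card_intRange (n : ℕ) : (intRange n).card = n := by simp [intRange]

theorem card_below_intRange {n i : ℕ} (h : i < n) : (below (intRange n) i).card = i := by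
  rw [show below (intRange n) i = Finset.Ico 0 (i : ℤ) by
    ext x; rw [mem_below, mem_intRange, Finset.mem_Ico]; omega]
  simp

theorem card_above_intRange (n i : ℕ) : (above (intRange n) i).card = n - 1 - i := by
  rw [show above (intRange n) i = Finset.Ico ((i : ℤ) + 1) n by
    ext x; rw [mem_above, mem_intRange, Finset.mem_Ico]; omega]
  rw [Int.card_Ico]; omega

theorem card_between_intRange {n i j : ℕ} (h : j < n) :
    (between (intRange n) i j).card = j - i - 1 := by
  rw [show between (intRange n) i j = Finset.Ico ((i : ℤ) + 1) j by
    ext x; rw [mem_between, mem_intRange, Finset.mem_Ico]; omega]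
  rw [Int.card_Ico]; omega

open scoped Classical in
/-- The number of pairs of a `123`-avoiding permutation and two of its fixed points. -/
theorem sum_card_avoiders_two_fixed (N : ℕ) :
    ((∑ p ∈ (Finset.range (N + 2) ×ˢ Finset.range (N + 2)).filter fun p => p.1 < p.2,
      ((avoiders (intRange (N + 2))).filter fun S =>
        ((p.1 : ℤ), (p.1 : ℤ)) ∈ S ∧ ((p.2 : ℤ), (p.2 : ℤ)) ∈ S).card : ℕ) : ℤ)
      = ballotConvSum 0 N := by
  have h1 : ∑ p ∈ (Finset.range (N + 2) ×ˢ Finset.range (N + 2)).filter (fun p => p.1 < p.2),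
      ((avoiders (intRange (N + 2))).filter fun S =>
        ((p.1 : ℤ), (p.1 : ℤ)) ∈ S ∧ ((p.2 : ℤ), (p.2 : ℤ)) ∈ S).card
      = ∑ q ∈ (Finset.range (N + 1)).sigma fun m => Finset.range (N - m + 1),
        twoFixedCount q.2 q.1 (N - q.1 - q.2) := by
    -- The pair i < j is encoded by the gap m = j - i - 1 and the number a = i of points below; N -
    -- m - a points lie above.
    refine Finset.sum_nbij' (fun p => ⟨p.2 - p.1 - 1, p.1⟩) (fun q => (q.2, q.2 + q.1 + 1))
      ?_ ?_ ?_ ?_ ?_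
    · rintro ⟨i, j⟩ h
      simp only [Finset.mem_filter, Finset.mem_product, Finset.mem_range, Finset.mem_sigma] at h ⊢
      omega
    · rintro ⟨m, a⟩ h
      simp only [Finset.mem_filter, Finset.mem_product, Finset.mem_range, Finset.mem_sigma] at h ⊢
      omega
    · rintro ⟨i, j⟩ h
      simp only [Finset.mem_filter, Finset.mem_product, Finset.mem_range] at h
      exact Prod.ext rfl (by dsimp only; omega)
    · rintro ⟨m, a⟩ h
      simp only [Sigma.mk.injEq, heq_eq_eq, and_true]
      omega
    · rintro ⟨i, j⟩ h
      simp only [Finset.mem_filter, Finset.mem_product, Finset.mem_range] at h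
      have hij : (i : ℤ) < j := by exact_mod_cast h.2
      rw [card_avoiders_two_fixed hij (mem_intRange.2 (by omega)) (mem_intRange.2 (by omega)),
        sum_card_cornerAvoiders (card_below_intRange h.1.1) (card_between_intRange h.1.2)
          (card_above_intRange _ j)]
      dsimp only
      congr 1
      omega
  rw [h1, Finset.sum_sigma, ballotConvSum, Nat.cast_sum]
  exact Finset.sum_congr rfl fun m _ => sum_twoFixedCount (N - m) m

/-! ### Hook avoiders, the complements of a fixed left-to-right minimum. -/

section Hook

/-- `S` is the graph of a `123`-avoiding bijection from `A ∪ C` onto `V ∪ H` that sends no point of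
`A` into `V` and is decreasing where it maps `C` into `H`. -/
structure IsHookAvoider (A C V H : Finset ℤ) (S : Finset (ℤ × ℤ)) : Prop where
  bij : IsBijGraph (A ∪ C) (V ∪ H) S
  avoids : Avoids123 S
  corner : ∀ {x y}, (x, y) ∈ S → x ∈ A → y ∉ V
  anti : ∀ {x y x' y'}, (x, y) ∈ S → (x', y') ∈ S → x ∈ C → x' ∈ C → y ∈ H → y' ∈ H →
    x < x' → y' < y

/-- The set of all `S` with `IsHookAvoider A C V H S`. -/
noncomputable def hookAvoiders (A C V H : Finset ℤ) : Finset (Finset (ℤ × ℤ)) :=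
  letI := Classical.decPred (IsHookAvoider A C V H)
  ((A ∪ C) ×ˢ (V ∪ H)).powerset.filter (IsHookAvoider A C V H)

/-- `F` is the graph of a `123`-avoiding bijection from `C \ Y` onto `V` that creates no `12` to
the left of a point of `Y`. -/
structure IsTailAvoider (C Y V : Finset ℤ) (F : Finset (ℤ × ℤ)) : Prop where
  bij : IsBijGraph (C \ Y) V F
  avoids : Avoids123 F
  left : ∀ {x y x' y' t}, (x, y) ∈ F → (x', y') ∈ F → t ∈ Y → x < x' → y < y' → x' < t → False

/-- The set of all `F` with `IsTailAvoider C Y V F`. -/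
noncomputable def tailAvoiders (C Y V : Finset ℤ) : Finset (Finset (ℤ × ℤ)) :=
  letI := Classical.decPred (IsTailAvoider C Y V)
  ((C \ Y) ×ˢ V).powerset.filter (IsTailAvoider C Y V)

variable {A C V H Y : Finset ℤ} {S E F : Finset (ℤ × ℤ)}

theorem mem_hookAvoiders : S ∈ hookAvoiders A C V H ↔ IsHookAvoider A C V H S := by
  classical
  rw [hookAvoiders, Finset.mem_filter, Finset.mem_powerset, and_iff_right_iff_imp]
  rintro h ⟨x, y⟩ hxy
  exact Finset.mem_product.2 ⟨h.bij.fst_mem hxy, h.bij.snd_mem hxy⟩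

theorem mem_tailAvoiders : F ∈ tailAvoiders C Y V ↔ IsTailAvoider C Y V F := by
  classical
  rw [tailAvoiders, Finset.mem_filter, Finset.mem_powerset, and_iff_right_iff_imp]
  rintro h ⟨x, y⟩ hxy
  exact Finset.mem_product.2 ⟨h.bij.fst_mem hxy, h.bij.snd_mem hxy⟩

/-- The positions in `C` that `S` sends into `H`. -/
def positionsInto (C H : Finset ℤ) (S : Finset (ℤ × ℤ)) : Finset ℤ :=
  C.filter fun x => ∃ y ∈ H, (x, y) ∈ S

theorem mem_positionsInto {x : ℤ} :
    x ∈ positionsInto C H S ↔ x ∈ C ∧ ∃ y ∈ H, (x, y) ∈ S := Finset.mem_filter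

theorem IsBijGraph.mem_positionsInto_iff {I J : Finset ℤ} (h : IsBijGraph I J S) {x y : ℤ}
    (hxy : (x, y) ∈ S) : x ∈ positionsInto C H S ↔ x ∈ C ∧ y ∈ H := by
  rw [mem_positionsInto]
  refine and_congr_right fun _ => ⟨?_, fun hy => ⟨y, hy, hxy⟩⟩
  rintro ⟨y', hy', hxy'⟩
  rwa [h.snd_unique hxy hxy']

theorem IsHookAvoider.cases (hVH : Disjoint V H) (h : IsHookAvoider A C V H S) {x y : ℤ}
    (hxy : (x, y) ∈ S) :
    (x ∈ A ∧ y ∈ H ∧ y ∉ V) ∨ (x ∈ C ∧ y ∈ H ∧ y ∉ V) ∨ (x ∈ C ∧ y ∈ V ∧ y ∉ H) := by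
  have h1 := Finset.mem_union.1 (h.bij.fst_mem hxy)
  have h2 := Finset.mem_union.1 (h.bij.snd_mem hxy)
  have h3 := h.corner hxy
  have h4 : y ∈ V → y ∉ H := fun k => Finset.disjoint_left.1 hVH k
  tauto

theorem IsHookAvoider.corner_part (hAC : Disjoint A C) (hVH : Disjoint V H)
    (h : IsHookAvoider A C V H S) :
    IsCornerAvoider A (positionsInto C H S) ∅ H
      (S.filter fun p => p.1 ∈ A ∪ positionsInto C H S) := by
  refine ⟨h.bij.filter ?_ ?_ ?_, h.avoids.mono (Finset.filter_subset _ _), by simp, ?_, by simp⟩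
  · exact Finset.union_subset_union_right (Finset.filter_subset _ _)
  · rw [Finset.empty_union]
    exact Finset.subset_union_right
  · intro x y hxy
    rw [Finset.mem_union, h.bij.mem_positionsInto_iff hxy, Finset.empty_union]
    have := h.cases hVH hxy
    have hx : x ∈ A → x ∉ C := fun k => Finset.disjoint_left.1 hAC k
    tauto
  · intro x y x' y' hxy hxy' hx hx' hlt
    have hxy := (Finset.mem_filter.1 hxy).1
    have hxy' := (Finset.mem_filter.1 hxy').1
    rw [h.bij.mem_positionsInto_iff hxy] at hx
    rw [h.bij.mem_positionsInto_iff hxy'] at hx'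
    exact h.anti hxy hxy' hx.1 hx'.1 hx.2 hx'.2 hlt

theorem IsHookAvoider.tail_part (hAC : Disjoint A C) (hVH : ∀ x ∈ V, ∀ y ∈ H, x < y)
    (h : IsHookAvoider A C V H S) :
    IsTailAvoider C (positionsInto C H S) V
      (S.filter fun p => p.1 ∈ C \ positionsInto C H S) := by
  have hd : Disjoint V H := Finset.disjoint_left.2 fun x hx hx' => lt_irrefl _ (hVH x hx x hx')
  have hb : ∀ {x y}, (x, y) ∈ S → (x ∈ C \ positionsInto C H S ↔ y ∈ V) := by
    intro x y hxy
    rw [Finset.mem_sdiff, h.bij.mem_positionsInto_iff hxy]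
    have := h.cases hd hxy
    have hx : x ∈ A → x ∉ C := fun k => Finset.disjoint_left.1 hAC k
    tauto
  refine ⟨h.bij.filter ?_ Finset.subset_union_left hb,
    h.avoids.mono (Finset.filter_subset _ _), ?_⟩
  · exact Finset.sdiff_subset.trans Finset.subset_union_right
  · intro x y x' y' t hxy hxy' ht h1 h2 h3
    obtain ⟨_, z, hz, htz⟩ := mem_positionsInto.1 ht
    have hxy' := Finset.mem_filter.1 hxy'
    exact h.avoids (Finset.mem_filter.1 hxy).1 hxy'.1 htz h1 h3 h2
      (hVH y' ((hb hxy'.1).1 hxy'.2) z hz)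

/-- Values in V lie below those in H, so in a mixed 123 the points of F precede those of E, and the
latter have positions in Y. One point of F and two of E contradict the decrease on Y; two of F and
one of E contradict `left`. -/
theorem isHookAvoider_union (hAC : ∀ x ∈ A, ∀ y ∈ C, x < y) (hVH : ∀ x ∈ V, ∀ y ∈ H, x < y)
    (hY : Y ⊆ C) (hE : IsCornerAvoider A Y ∅ H E) (hF : IsTailAvoider C Y V F) :
    IsHookAvoider A C V H (E ∪ F) := by
  have e1 : ∀ {x y}, (x, y) ∈ E → (x ∈ A ∨ x ∈ Y) ∧ y ∈ H := fun hxy =>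
    ⟨Finset.mem_union.1 (hE.bij.fst_mem hxy), by simpa using hE.bij.snd_mem hxy⟩
  have f1 : ∀ {x y}, (x, y) ∈ F → x ∈ C ∧ x ∉ Y ∧ y ∈ V := fun hxy =>
    ⟨(Finset.mem_sdiff.1 (hF.bij.fst_mem hxy)).1, (Finset.mem_sdiff.1 (hF.bij.fst_mem hxy)).2,
      hF.bij.snd_mem hxy⟩
  have e2 : ∀ {x y x' y'}, (x, y) ∈ E → (x', y') ∈ E → x ∈ C → x < x' → y' < y := by
    intro x y x' y' h1 h2 h3 hlt
    have hx : x ∈ Y := (e1 h1).1.resolve_left fun k => lt_irrefl _ (hAC x k x h3)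
    have hx' : x' ∈ Y := (e1 h2).1.resolve_left fun k => lt_asymm hlt (hAC x' k x h3)
    exact hE.anti_fst h1 h2 hx hx' hlt
  refine ⟨?_, ?_, ?_, ?_⟩
  · have := hE.bij.union hF.bij ?_ ?_
    · rwa [Finset.empty_union, Finset.union_comm H, Finset.union_assoc,
        Finset.union_sdiff_of_subset hY] at this
    · rw [Finset.disjoint_left]
      intro x hx hx'
      have h1 := Finset.mem_sdiff.1 hx'
      rcases Finset.mem_union.1 hx with hx | hx
      · exact lt_irrefl _ (hAC x hx x h1.1)
      · exact h1.2 hx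
    · rw [Finset.empty_union, Finset.disjoint_left]
      exact fun x hx hx' => lt_irrefl _ (hVH x hx' x hx)
  · intro x₁ y₁ x₂ y₂ x₃ y₃ h1 h2 h3 a b c d
    rcases Finset.mem_union.1 h1 with k1 | k1
    · have k2 : (x₂, y₂) ∈ E := (Finset.mem_union.1 h2).resolve_right fun k =>
        lt_asymm c (hVH _ (f1 k).2.2 _ (e1 k1).2)
      have k3 : (x₃, y₃) ∈ E := (Finset.mem_union.1 h3).resolve_right fun k =>
        lt_asymm d (hVH _ (f1 k).2.2 _ (e1 k2).2)
      exact hE.avoids k1 k2 k3 a b c d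
    · rcases Finset.mem_union.1 h3 with k3 | k3
      · have hx3 : x₃ ∈ Y := (e1 k3).1.resolve_left fun k =>
          lt_asymm (a.trans b) (hAC _ k _ (f1 k1).1)
        rcases Finset.mem_union.1 h2 with k2 | k2
        · have hx2 : x₂ ∈ Y := (e1 k2).1.resolve_left fun k => lt_asymm a (hAC _ k _ (f1 k1).1)
          exact lt_asymm d (e2 k2 k3 (hY hx2) b)
        · exact hF.left k1 k2 hx3 a c b
      · have k2 : (x₂, y₂) ∈ F := (Finset.mem_union.1 h2).resolve_left fun k =>
          lt_asymm d (hVH _ (f1 k3).2.2 _ (e1 k).2)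
        exact hF.avoids k1 k2 k3 a b c d
  · intro x y hxy hx hy
    rcases Finset.mem_union.1 hxy with k | k
    · exact lt_irrefl _ (hVH y hy y (e1 k).2)
    · exact lt_irrefl _ (hAC x hx x (f1 k).1)
  · intro x y x' y' hxy hxy' hx hx' hy hy' hlt
    have k : (x, y) ∈ E := (Finset.mem_union.1 hxy).resolve_right fun k =>
      lt_irrefl _ (hVH _ (f1 k).2.2 _ hy)
    have k' : (x', y') ∈ E := (Finset.mem_union.1 hxy').resolve_right fun k =>
      lt_irrefl _ (hVH _ (f1 k).2.2 _ hy')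
    exact e2 k k' hx hlt

theorem positionsInto_union (hVH : ∀ x ∈ V, ∀ y ∈ H, x < y) (hY : Y ⊆ C)
    (hAC : ∀ x ∈ A, ∀ y ∈ C, x < y)
    (hE : IsCornerAvoider A Y ∅ H E) (hF : IsTailAvoider C Y V F) :
    positionsInto C H (E ∪ F) = Y := by
  ext x
  rw [mem_positionsInto]
  constructor
  · rintro ⟨hx, y, hy, hxy⟩
    rcases Finset.mem_union.1 hxy with k | k
    · exact (Finset.mem_union.1 (hE.bij.fst_mem k)).resolve_left
        fun hA => lt_irrefl _ (hAC x hA x hx)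
    · exact absurd (hVH y (hF.bij.snd_mem k) y hy) (lt_irrefl _)
  · intro hx
    obtain ⟨y, hy⟩ := hE.bij.exists_snd (Finset.mem_union_right _ hx)
    exact ⟨hY hx, y, by simpa using hE.bij.snd_mem hy, Finset.mem_union_left _ hy⟩

theorem card_hookAvoiders_eq_sum (hAC : ∀ x ∈ A, ∀ y ∈ C, x < y)
    (hVH : ∀ x ∈ V, ∀ y ∈ H, x < y) :
    (hookAvoiders A C V H).card =
      ∑ Y ∈ C.powerset, (cornerAvoiders A Y ∅ H).card * (tailAvoiders C Y V).card := by
  have hAC' : Disjoint A C :=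
    Finset.disjoint_left.2 fun x hx hx' => lt_irrefl _ (hAC x hx x hx')
  have hVH' : Disjoint V H :=
    Finset.disjoint_left.2 fun x hx hx' => lt_irrefl _ (hVH x hx x hx')
  have hd : ∀ Y ⊆ C, Disjoint (A ∪ Y) (C \ Y) := by
    intro Y hY
    rw [Finset.disjoint_left]
    intro x hx hx'
    have h1 := Finset.mem_sdiff.1 hx'
    rcases Finset.mem_union.1 hx with hx | hx
    · exact lt_irrefl _ (hAC x hx x h1.1)
    · exact h1.2 hx
  rw [Finset.card_eq_sum_card_fiberwise (f := positionsInto C H) (t := C.powerset)]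
  · refine Finset.sum_congr rfl fun Y hY => ?_
    rw [Finset.mem_powerset] at hY
    rw [← Finset.card_product]
    refine Finset.card_nbij' (fun S => (S.filter fun p => p.1 ∈ A ∪ Y,
      S.filter fun p => p.1 ∈ C \ Y)) (fun EF => EF.1 ∪ EF.2) ?_ ?_ ?_ ?_
    · intro S hS
      simp only [Finset.coe_filter, Set.mem_ofPred_eq, mem_hookAvoiders] at hS
      obtain ⟨h, rfl⟩ := hS
      simp only [Finset.mem_coe, Finset.mem_product, mem_cornerAvoiders, mem_tailAvoiders]
      exact ⟨h.corner_part hAC' hVH', h.tail_part hAC' hVH⟩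
    · rintro ⟨E, F⟩ hEF
      simp only [Finset.mem_coe, Finset.mem_product, mem_cornerAvoiders, mem_tailAvoiders] at hEF
      simp only [Finset.coe_filter, Set.mem_ofPred_eq, mem_hookAvoiders]
      exact ⟨isHookAvoider_union hAC hVH hY hEF.1 hEF.2,
        positionsInto_union hVH hY hAC hEF.1 hEF.2⟩
    · intro S hS
      simp only [Finset.coe_filter, Set.mem_ofPred_eq, mem_hookAvoiders] at hS
      refine hS.1.bij.filter_union_filter ?_
      rw [Finset.union_assoc, Finset.union_sdiff_of_subset hY]
    · rintro ⟨E, F⟩ hEF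
      simp only [Finset.mem_coe, Finset.mem_product, mem_cornerAvoiders, mem_tailAvoiders] at hEF
      refine Prod.ext (hEF.1.bij.filter_union_left hEF.2.bij (hd Y hY)) ?_
      dsimp only
      rw [Finset.union_comm]
      exact hEF.2.bij.filter_union_left hEF.1.bij (hd Y hY).symm
  · exact fun S _ => Finset.mem_coe.2 (Finset.mem_powerset.2 (Finset.filter_subset _ _))

/-- Counting points forces |Y| = p, and the corner factor depends on Y only through its size. The
remaining sum of tails involves neither A nor H, except through p. -/
theorem card_hookAvoiders_eq_mul {p : ℕ} (hAC : ∀ x ∈ A, ∀ y ∈ C, x < y)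
    (hVH : ∀ x ∈ V, ∀ y ∈ H, x < y) (hp : A.card + p = H.card) :
    (hookAvoiders A C V H).card =
      ballot (A.card + H.card) p * ∑ Y ∈ C.powersetCard p, (tailAvoiders C Y V).card := by
  rw [card_hookAvoiders_eq_sum hAC hVH, Finset.mul_sum]
  symm
  refine Finset.sum_subset_zero_on_sdiff ?_ ?_ ?_
  · exact fun Y hY => Finset.mem_powerset.2 (Finset.mem_powersetCard.1 hY).1
  · intro Y hY
    rw [Finset.mem_sdiff, Finset.mem_powerset, Finset.mem_powersetCard] at hY
    rw [cornerAvoiders_eq_empty_of_card_ne, Finset.card_empty, zero_mul]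
    · exact Finset.disjoint_left.2 fun x hx hx' => lt_irrefl _ (hAC x hx x (hY.1 hx'))
    · simp
    · rw [Finset.card_empty]
      have : Y.card ≠ p := fun h => hY.2 ⟨hY.1, h⟩
      omega
  · intro Y hY
    obtain ⟨hYC, rfl⟩ := Finset.mem_powersetCard.1 hY
    rw [card_cornerAvoiders (A.card + H.card) A Y ∅ H (fun x hx y hy => hAC x hx y (hYC hy))
      (by simp) (by simpa using hp) rfl]
    simp

theorem ballot_self (s : ℕ) : ballot s s = 1 := by
  induction s with
  | zero => rw [ballot]
  | succ s ih => rw [ballot_succ_succ, ih, ballot_eq_zero_of_lt (by omega)]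

theorem card_hookAvoiders_empty (hVH : ∀ x ∈ V, ∀ y ∈ H, x < y)
    (hc : C.card = V.card + H.card) :
    (hookAvoiders ∅ C V H).card = ballot (C.card + V.card) H.card := by
  have h : hookAvoiders ∅ C V H = cornerAvoiders C ∅ H V := by
    ext S
    rw [mem_hookAvoiders, mem_cornerAvoiders]
    constructor
    · intro h
      have hbij := h.bij
      rw [Finset.union_comm, Finset.union_comm V] at hbij
      refine ⟨hbij, h.avoids, by simp, by simp, ?_⟩
      intro x y x' y' h1 h2 h3 h4
      exact h.anti h1 h2 (by simpa using hbij.fst_mem h1) (by simpa using hbij.fst_mem h2) h3 h4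
    · intro h
      have hbij := h.bij
      rw [Finset.union_comm, Finset.union_comm H] at hbij
      exact ⟨hbij, h.avoids, by simp, fun h1 h2 _ _ h3 h4 => h.anti_snd h1 h2 h3 h4⟩
  rw [h, card_cornerAvoiders_of_gt (s := C.card + V.card) (by simp)
    (fun x hx y hy => hVH y hy x hx) (by simp; omega) rfl]
  simp

/-- The number of hook avoiders is the square of a ballot number. -/
theorem card_hookAvoiders {a p : ℕ} (hAC : ∀ x ∈ A, ∀ y ∈ C, x < y)
    (hVH : ∀ x ∈ V, ∀ y ∈ H, x < y) (hA : A.card = a) (hV : V.card = a) (hC : C.card = a + p)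
    (hH : H.card = a + p) :
    (hookAvoiders A C V H).card = ballot (2 * a + p) p ^ 2 := by
  -- The sum of tails is evaluated by replacing A with ∅ and H with a subset of size p. The corner
  -- factor becomes `ballot p p = 1`, and the hook avoiders become corner avoiders, so the tails sum
  -- to `ballot (2 * a + p) p`: the same number as the corner factor of the original problem.
  obtain ⟨H', hH', hc⟩ := Finset.exists_subset_card_eq (show p ≤ H.card by omega)
  have hVH' : ∀ x ∈ V, ∀ y ∈ H', x < y := fun x hx y hy => hVH x hx y (hH' hy)
  have h1 := card_hookAvoiders_empty (C := C) hVH' (by omega)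
  rw [card_hookAvoiders_eq_mul (p := p) (by simp) hVH' (by simpa using hc.symm), Finset.card_empty,
    zero_add, hc, ballot_self, one_mul] at h1
  rw [card_hookAvoiders_eq_mul hAC hVH (p := p) (by omega), h1, sq]
  congr 2 <;> omega

theorem hookAvoiders_eq_empty (hAC : ∀ x ∈ A, ∀ y ∈ C, x < y)
    (hVH : ∀ x ∈ V, ∀ y ∈ H, x < y) (h : H.card < A.card) : hookAvoiders A C V H = ∅ := by
  rw [← Finset.card_eq_zero, card_hookAvoiders_eq_sum hAC hVH]
  refine Finset.sum_eq_zero fun Y hY => ?_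
  rw [Finset.mem_powerset] at hY
  rw [cornerAvoiders_eq_empty_of_card_ne, Finset.card_empty, zero_mul]
  · exact Finset.disjoint_left.2 fun x hx hx' => lt_irrefl _ (hAC x hx x (hY hx'))
  · simp
  · rw [Finset.card_empty]; omega

end Hook

/-! ### Avoiders with one prescribed fixed point. -/

section OneFixed

variable {I : Finset ℤ} {i : ℤ} {S T : Finset (ℤ × ℤ)}

/-- No point of `S` lies below and to the left of `(i, i)`. -/
def IsLeftMin (i : ℤ) (S : Finset (ℤ × ℤ)) : Prop := ∀ ⦃x y⦄, (x, y) ∈ S → x < i → i ≤ y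

/-- No point of `S` lies above and to the right of `(i, i)`. -/
def IsRightMax (i : ℤ) (S : Finset (ℤ × ℤ)) : Prop := ∀ ⦃x y⦄, (x, y) ∈ S → i < x → y ≤ i

/-- The number of `123`-avoiding permutations with a fixed left-to-right minimum that has `a` points
below and `c` points above it. -/
def leftMinCount (a c : ℕ) : ℕ := if a ≤ c then ballot (a + c) (c - a) ^ 2 else 0

theorem below_union_above_ne (I : Finset ℤ) (i : ℤ) : i ∉ below I i ∪ above I i := by
  rw [Finset.mem_union, mem_below, mem_above]; omega

theorem singleton_union_below_above (hi : i ∈ I) : {i} ∪ (below I i ∪ above I i) = I := by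
  ext x
  rw [Finset.mem_union, Finset.mem_union, Finset.mem_singleton, mem_below, mem_above]
  grind

-- Deleting (i, i) leaves no point in the lower left block, and the condition that (i, i) starts no
-- 123 becomes the decrease on the upper right block.
open scoped Classical in
theorem card_avoiders_leftMin_eq (hi : i ∈ I) :
    ((avoiders I).filter fun S => (i, i) ∈ S ∧ IsLeftMin i S).card =
      (hookAvoiders (below I i) (above I i) (below I i) (above I i)).card := by
  have hne := below_union_above_ne I i
  refine Finset.card_nbij' (fun S => S.erase (i, i)) (fun S => insert (i, i) S) ?_ ?_ ?_ ?_
  · intro S hS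
    simp only [Finset.coe_filter, Set.mem_ofPred_eq, mem_avoiders] at hS
    obtain ⟨h, hiS, hmin⟩ := hS
    have hb : ∀ {x y}, (x, y) ∈ S.erase (i, i) → (x, y) ∈ S ∧ x ≠ i ∧ y ≠ i := by
      intro x y hxy
      have h1 := Finset.mem_of_mem_erase hxy
      have h2 := Finset.ne_of_mem_erase hxy
      refine ⟨h1, ?_, ?_⟩
      · rintro rfl
        exact h2 (by rw [h.1.snd_unique h1 hiS])
      · rintro rfl
        exact h2 (by rw [h.1.fst_unique h1 hiS])
    rw [Finset.mem_coe, mem_hookAvoiders]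
    refine ⟨?_, h.2.mono (Finset.erase_subset _ _), ?_, ?_⟩
    · have hf := h.1.filter (I₁ := below I i ∪ above I i) (J₁ := below I i ∪ above I i) ?_ ?_ ?_
      · convert hf using 1
        ext ⟨x, y⟩
        rw [Finset.mem_filter]
        constructor
        · intro hxy
          obtain ⟨h1, h2, _⟩ := hb hxy
          have h3 := h.1.fst_mem h1
          refine ⟨h1, ?_⟩
          simp only [Finset.mem_union, mem_below, mem_above, h3, true_and]
          omega
        · rintro ⟨h1, h2⟩
          refine Finset.mem_erase.2 ⟨?_, h1⟩
          rintro h3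
          rw [Prod.mk.injEq] at h3
          obtain ⟨rfl, rfl⟩ := h3
          exact hne h2
      · exact (Finset.union_subset (Finset.filter_subset _ _) (Finset.filter_subset _ _))
      · exact (Finset.union_subset (Finset.filter_subset _ _) (Finset.filter_subset _ _))
      · intro x y hxy
        simp only [Finset.mem_union, mem_below, mem_above, h.1.fst_mem hxy, h.1.snd_mem hxy,
          true_and]
        have h1 : x = i → y = i := by rintro rfl; exact h.1.snd_unique hxy hiS
        have h2 : y = i → x = i := by rintro rfl; exact h.1.fst_unique hxy hiS
        omega
    · intro x y hxy hx hy
      have := hmin (hb hxy).1 (mem_below.1 hx).2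
      exact this.not_gt (mem_below.1 hy).2
    · intro x y x' y' hxy hxy' hx hx' hy hy' hlt
      by_contra! hle
      rcases hle.lt_or_eq with hle | rfl
      · exact h.2 hiS (hb hxy).1 (hb hxy').1 (mem_above.1 hx).2 hlt (mem_above.1 hy).2 hle
      · exact hlt.ne (h.1.fst_unique (hb hxy).1 (hb hxy').1)
  · intro S hS
    rw [Finset.mem_coe, mem_hookAvoiders] at hS
    simp only [Finset.coe_filter, Set.mem_ofPred_eq, mem_avoiders]
    have hm : ∀ {x y}, (x, y) ∈ insert (i, i) S ↔ (x = i ∧ y = i) ∨ (x, y) ∈ S := by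
      intro x y; simp
    have hd : Disjoint (below I i) (above I i) := by
      rw [Finset.disjoint_left]
      intro x hx hx'
      have := (mem_below.1 hx).2
      have := (mem_above.1 hx').2
      omega
    have hc : ∀ {x y}, (x, y) ∈ S → (x < i ∧ i < y) ∨ (i < x ∧ i < y) ∨ (i < x ∧ y < i) := by
      intro x y hxy
      have h1 := hS.cases hd hxy
      simp only [mem_below, mem_above] at h1
      omega
    have ha : ∀ {x y x' y'}, (x, y) ∈ S → (x', y') ∈ S → i < x → x < x' → i < y → i < y' →
        y' < y := by
      intro x y x' y' h1 h2 h3 h4 h5 h6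
      have k1 := hS.cases hd h1
      have k2 := hS.cases hd h2
      simp only [mem_below, mem_above] at k1 k2
      exact hS.anti h1 h2 (mem_above.2 (by grind)) (mem_above.2 (by grind))
        (mem_above.2 (by grind)) (mem_above.2 (by grind)) h4
    refine ⟨⟨?_, ?_⟩, Finset.mem_insert_self _ _, ?_⟩
    · have := (isBijGraph_singleton i i).union hS.bij (by simpa using hne) (by simpa using hne)
      rwa [singleton_union_below_above hi] at this
    · intro x₁ y₁ x₂ y₂ x₃ y₃ h1 h2 h3 a b c d
      rcases hm.1 h1 with k1 | k1 <;> rcases hm.1 h2 with k2 | k2 <;>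
        rcases hm.1 h3 with k3 | k3 <;>
        (try have b1 := hc k1) <;> (try have b2 := hc k2) <;> (try have b3 := hc k3) <;>
        (try have g1 := ha k2 k3) <;>
        first
        | omega
        | exact hS.avoids k1 k2 k3 a b c d
    · intro x y hxy hlt
      rcases hm.1 hxy with k | k
      · omega
      · have := hc k
        omega
  · intro S hS
    simp only [Finset.coe_filter, Set.mem_ofPred_eq] at hS
    exact Finset.insert_erase hS.2.1
  · intro S hS
    rw [Finset.mem_coe, mem_hookAvoiders] at hS
    exact Finset.erase_insert fun hiS => hne (hS.bij.fst_mem hiS)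

open scoped Classical in
theorem card_avoiders_leftMin (hi : i ∈ I) :
    ((avoiders I).filter fun S => (i, i) ∈ S ∧ IsLeftMin i S).card =
      leftMinCount (below I i).card (above I i).card := by
  have h : ∀ x ∈ below I i, ∀ y ∈ above I i, x < y := by
    intro x hx y hy
    have := (mem_below.1 hx).2
    have := (mem_above.1 hy).2
    omega
  rw [card_avoiders_leftMin_eq hi, leftMinCount]
  split_ifs with hle
  · obtain ⟨p, hp⟩ := Nat.exists_eq_add_of_le hle
    rw [card_hookAvoiders (p := p) h h rfl rfl hp hp, hp]
    congr 2 <;> omega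
  · rw [hookAvoiders_eq_empty h h (by omega), Finset.card_empty]

theorem IsAvoider.halfTurn (h : IsAvoider I S) : IsAvoider (negSet I) (halfTurn S) :=
  ⟨h.1.halfTurn, h.2.halfTurn⟩

theorem IsRightMax.halfTurn (h : IsRightMax i S) : IsLeftMin (-i) (halfTurn S) := by
  intro x y hxy hlt
  have := h (mem_halfTurn.1 hxy) (by omega)
  omega

theorem IsLeftMin.halfTurn (h : IsLeftMin i S) : IsRightMax (-i) (halfTurn S) := by
  intro x y hxy hlt
  have := h (mem_halfTurn.1 hxy) (by omega)
  omega

theorem below_negSet : below (negSet I) (-i) = negSet (above I i) := by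
  ext x
  rw [mem_below, mem_negSet, mem_negSet, mem_above]
  exact and_congr_right fun _ => by omega

theorem above_negSet : above (negSet I) (-i) = negSet (below I i) := by
  ext x
  rw [mem_above, mem_negSet, mem_negSet, mem_below]
  exact and_congr_right fun _ => by omega

open scoped Classical in
theorem card_avoiders_rightMax (hi : i ∈ I) :
    ((avoiders I).filter fun S => (i, i) ∈ S ∧ IsRightMax i S).card =
      leftMinCount (above I i).card (below I i).card := by
  rw [← card_negSet (above I i), ← card_negSet (below I i), ← below_negSet, ← above_negSet,
    ← card_avoiders_leftMin (mem_negSet.2 (by rwa [neg_neg]))]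
  refine Finset.card_nbij' halfTurn halfTurn ?_ ?_ ?_ ?_
  · intro S hS
    simp only [Finset.coe_filter, Set.mem_ofPred_eq, mem_avoiders] at hS ⊢
    exact ⟨hS.1.halfTurn, mem_halfTurn.2 (by simpa using hS.2.1), IsRightMax.halfTurn hS.2.2⟩
  · intro S hS
    simp only [Finset.coe_filter, Set.mem_ofPred_eq, mem_avoiders] at hS ⊢
    refine ⟨?_, mem_halfTurn.2 hS.2.1, ?_⟩
    · have := hS.1.halfTurn
      rwa [negSet_negSet] at this
    · have := IsLeftMin.halfTurn hS.2.2
      rwa [neg_neg] at this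
  · exact fun S _ => halfTurn_halfTurn S
  · exact fun S _ => halfTurn_halfTurn S

theorem IsAvoider.leftMin_or_rightMax (h : IsAvoider I S) (hi : (i, i) ∈ S) :
    IsLeftMin i S ∨ IsRightMax i S := by
  by_contra! hcon
  simp only [IsLeftMin, IsRightMax, not_forall, not_le] at hcon
  obtain ⟨⟨x, y, hxy, h1, h2⟩, ⟨x', y', hxy', h3, h4⟩⟩ := hcon
  exact h.2 hxy hi hxy' h1 h3 h2 h4

/-- With both diagonal blocks empty, the graph restricts to a bijection from the positions below i
onto the values above i. -/
theorem IsAvoider.card_below_eq (h : IsAvoider I S) (hi : (i, i) ∈ S) (h1 : IsLeftMin i S)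
    (h2 : IsRightMax i S) : (below I i).card = (above I i).card := by
  refine IsBijGraph.card_eq (S := S.filter fun p => p.1 ∈ below I i)
    (h.1.filter (Finset.filter_subset _ _) (Finset.filter_subset _ _) ?_)
  intro x y hxy
  simp only [mem_below, mem_above, h.1.fst_mem hxy, h.1.snd_mem hxy, true_and]
  have k1 := h1 hxy
  have k2 := h2 hxy
  have k3 : y = i → x = i := by rintro rfl; exact h.1.fst_unique hxy hi
  have k4 : x = i → y = i := by rintro rfl; exact h.1.snd_unique hxy hi
  omega

end OneFixed

/-- The heights s - 2i are exactly the heights k ≤ s with the parity of s; the other terms of ∑ₖ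
`ballot s k ^ 2` vanish. -/
theorem sum_leftMinCount (s : ℕ) :
    ∑ i ∈ Finset.range (s + 1), leftMinCount i (s - i) = ballot (2 * s) 0 := by
  rw [← sum_ballot_sq s (s + 1) (by omega)]
  have h1 : ∑ i ∈ Finset.range (s + 1), leftMinCount i (s - i)
      = ∑ i ∈ (Finset.range (s + 1)).filter (fun i => 2 * i ≤ s), ballot s (s - 2 * i) ^ 2 := by
    rw [Finset.sum_filter]
    refine Finset.sum_congr rfl fun i hi => ?_
    rw [Finset.mem_range] at hi
    rw [leftMinCount, show i + (s - i) = s by omega, show s - i - i = s - 2 * i by omega]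
    exact if_congr (by omega) rfl rfl
  have h2 : ∑ k ∈ Finset.range (s + 1), ballot s k ^ 2
      = ∑ k ∈ (Finset.range (s + 1)).filter (fun k => ¬ Odd (s + k)), ballot s k ^ 2 := by
    rw [Finset.sum_filter]
    refine Finset.sum_congr rfl fun k _ => ?_
    split_ifs with h
    · rw [ballot_eq_zero_of_odd h]; rfl
    · rfl
  rw [h1, h2]
  refine Finset.sum_nbij' (fun i => s - 2 * i) (fun k => (s - k) / 2) ?_ ?_ ?_ ?_ ?_
  · intro i hi
    simp only [Finset.mem_filter, Finset.mem_range, Nat.odd_iff] at hi ⊢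
    omega
  · intro i hi
    simp only [Finset.mem_filter, Finset.mem_range, Nat.odd_iff] at hi ⊢
    omega
  · intro i hi
    simp only [Finset.mem_filter, Finset.mem_range] at hi ⊢
    omega
  · intro i hi
    simp only [Finset.mem_filter, Finset.mem_range, Nat.odd_iff] at hi ⊢
    omega
  · intro i _
    rfl

/-! ### The total number of fixed points. -/

section Total

open scoped Classical

/-- The number of pairs of a `123`-avoiding permutation of `n` letters and a fixed point of it that
is both a left-to-right minimum and a right-to-left maximum. -/
noncomputable def centralFixedCount (n : ℕ) : ℕ :=
  ∑ i ∈ Finset.range n, ((avoiders (intRange n)).filter fun S =>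
    ((i : ℤ), (i : ℤ)) ∈ S ∧ IsLeftMin i S ∧ IsRightMax i S).card

/-- By `IsAvoider.card_below_eq` only the middle index i = s / 2 can contribute, and there the count
is at most that of left-to-right minima with equally many points on both sides. -/
theorem centralFixedCount_le (s : ℕ) : centralFixedCount (s + 1) ≤ ballot s 0 ^ 2 := by
  have h : ∀ i ∈ Finset.range (s + 1), ((avoiders (intRange (s + 1))).filter fun S =>
      ((i : ℤ), (i : ℤ)) ∈ S ∧ IsLeftMin i S ∧ IsRightMax i S).card
      ≤ if i = s / 2 then ballot s 0 ^ 2 else 0 := by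
    intro i hi
    rw [Finset.mem_range] at hi
    have hb := card_below_intRange hi
    have ha := card_above_intRange (s + 1) i
    by_cases hc : i = s - i
    · rw [if_pos (by omega)]
      refine (Finset.card_le_card fun S hS => ?_).trans ((card_avoiders_leftMin (i := (i : ℤ))
        (mem_intRange.2 (by omega) : (i : ℤ) ∈ intRange (s + 1))).le.trans ?_)
      · rw [Finset.mem_filter] at hS ⊢
        exact ⟨hS.1, hS.2.1, hS.2.2.1⟩
      · rw [hb, ha, leftMinCount, if_pos (by omega), show i + (s + 1 - 1 - i) = s by omega,
          show s + 1 - 1 - i - i = 0 by omega]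
    · rw [Finset.card_eq_zero.2]
      · exact Nat.zero_le _
      · refine Finset.eq_empty_of_forall_notMem fun S hS => hc ?_
        rw [Finset.mem_filter, mem_avoiders] at hS
        have := hS.1.card_below_eq hS.2.1 hS.2.2.1 hS.2.2.2
        rw [hb, ha] at this
        omega
  refine (Finset.sum_le_sum h).trans ?_
  rw [Finset.sum_ite_eq']
  split_ifs
  · exact le_rfl
  · exact Nat.zero_le _

/-- Inclusion and exclusion: every fixed point is a left-to-right minimum or a right-to-left
maximum, and each kind totals `ballot (2 * s) 0`. -/
theorem sum_card_avoiders_fixed (s : ℕ) :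
    ∑ i ∈ Finset.range (s + 1), ((avoiders (intRange (s + 1))).filter fun S =>
      ((i : ℤ), (i : ℤ)) ∈ S).card + centralFixedCount (s + 1) = 2 * ballot (2 * s) 0 := by
  have h : ∀ i ∈ Finset.range (s + 1), ((avoiders (intRange (s + 1))).filter fun S =>
      ((i : ℤ), (i : ℤ)) ∈ S).card + ((avoiders (intRange (s + 1))).filter fun S =>
        ((i : ℤ), (i : ℤ)) ∈ S ∧ IsLeftMin i S ∧ IsRightMax i S).card
      = leftMinCount i (s - i) + leftMinCount (s - i) i := by
    intro i hi
    rw [Finset.mem_range] at hi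
    have hi' : (i : ℤ) ∈ intRange (s + 1) := mem_intRange.2 (by omega)
    have h1 := card_avoiders_leftMin hi'
    have h2 := card_avoiders_rightMax hi'
    rw [card_below_intRange hi, card_above_intRange, Nat.add_sub_cancel] at h1 h2
    rw [← h1, ← h2, ← Finset.card_union_add_card_inter (Finset.filter _ _)
      (Finset.filter (fun S => ((i : ℤ), (i : ℤ)) ∈ S ∧ IsRightMax i S) _)]
    congr 2
    · ext S
      simp only [Finset.mem_filter, Finset.mem_union, mem_avoiders]
      constructor
      · rintro ⟨h, hS⟩
        have := h.leftMin_or_rightMax hS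
        tauto
      · tauto
    · ext S
      simp only [Finset.mem_filter, Finset.mem_inter]
      tauto
  rw [centralFixedCount, ← Finset.sum_add_distrib, Finset.sum_congr rfl h,
    Finset.sum_add_distrib, sum_leftMinCount, two_mul (ballot _ _)]
  congr 1
  rw [← sum_leftMinCount, ← Finset.sum_range_reflect]
  refine Finset.sum_congr rfl fun i hi => ?_
  rw [Finset.mem_range] at hi
  congr 1; omega

end Total

/-! ### From permutations of `Fin n` to point sets, and the counts by number of fixed points. -/

section Graph

variable {n : ℕ}

/-- The set of points `(k, σ k)`. -/
def graphPoints (σ : Equiv.Perm (Fin n)) : Finset (ℤ × ℤ) :=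
  Finset.univ.image fun k : Fin n => (((k : ℕ) : ℤ), ((σ k : ℕ) : ℤ))

theorem mem_graphPoints {σ : Equiv.Perm (Fin n)} {x y : ℤ} :
    (x, y) ∈ graphPoints σ ↔ ∃ k : Fin n, ((k : ℕ) : ℤ) = x ∧ ((σ k : ℕ) : ℤ) = y := by
  simp [graphPoints]

theorem coe_mem_graphPoints {σ : Equiv.Perm (Fin n)} {k l : Fin n} :
    (((k : ℕ) : ℤ), ((l : ℕ) : ℤ)) ∈ graphPoints σ ↔ σ k = l := by
  rw [mem_graphPoints]
  constructor
  · rintro ⟨m, h1, h2⟩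
    obtain rfl : m = k := Fin.ext (by exact_mod_cast h1)
    exact Fin.ext (by exact_mod_cast h2)
  · rintro rfl
    exact ⟨k, rfl, rfl⟩

theorem graphPoints_injective : Function.Injective (graphPoints (n := n)) := by
  intro σ τ h
  ext1 k
  have : (((k : ℕ) : ℤ), ((σ k : ℕ) : ℤ)) ∈ graphPoints τ := by
    rw [← h]; exact coe_mem_graphPoints.2 rfl
  exact (coe_mem_graphPoints.1 this).symm

theorem exists_fin_of_mem_intRange {x : ℤ} (hx : x ∈ intRange n) :
    ∃ k : Fin n, ((k : ℕ) : ℤ) = x := by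
  rw [mem_intRange] at hx
  exact ⟨⟨x.toNat, by omega⟩, by simp; omega⟩

theorem coe_mem_intRange (k : Fin n) : ((k : ℕ) : ℤ) ∈ intRange n :=
  mem_intRange.2 ⟨by omega, by exact_mod_cast k.2⟩

theorem isBijGraph_graphPoints (σ : Equiv.Perm (Fin n)) :
    IsBijGraph (intRange n) (intRange n) (graphPoints σ) where
  fst_mem hxy := by
    obtain ⟨k, rfl, -⟩ := mem_graphPoints.1 hxy
    exact coe_mem_intRange k
  snd_mem hxy := by
    obtain ⟨k, -, rfl⟩ := mem_graphPoints.1 hxy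
    exact coe_mem_intRange _
  exists_snd hx := by
    obtain ⟨k, rfl⟩ := exists_fin_of_mem_intRange hx
    exact ⟨_, coe_mem_graphPoints.2 rfl⟩
  exists_fst hx := by
    obtain ⟨k, rfl⟩ := exists_fin_of_mem_intRange hx
    exact ⟨_, coe_mem_graphPoints.2 (σ.apply_symm_apply k)⟩
  snd_unique h1 h2 := by
    obtain ⟨k, rfl, rfl⟩ := mem_graphPoints.1 h1
    obtain ⟨l, h, rfl⟩ := mem_graphPoints.1 h2
    rw [Fin.ext (show (l : ℕ) = k by exact_mod_cast h)]
  fst_unique h1 h2 := by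
    obtain ⟨k, rfl, rfl⟩ := mem_graphPoints.1 h1
    obtain ⟨l, rfl, h⟩ := mem_graphPoints.1 h2
    rw [σ.injective (Fin.ext (show (σ l : ℕ) = σ k by exact_mod_cast h))]

theorem containsPattern_123_iff {σ : Equiv.Perm (Fin n)} :
    ContainsPattern pattern123 σ ↔ ∃ a b c : Fin n, a < b ∧ b < c ∧ σ a < σ b ∧ σ b < σ c := by
  constructor
  · rintro ⟨i, hi, h⟩
    exact ⟨i 0, i 1, i 2, hi (by decide), hi (by decide), (h 0 1).2 (by simp [pattern123]),
      (h 1 2).2 (by simp [pattern123])⟩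
  · rintro ⟨a, b, c, h1, h2, h3, h4⟩
    have hmono : ∀ f : Fin 3 → Fin n, f 0 < f 1 → f 1 < f 2 → StrictMono f := by
      intro f h h'
      refine Fin.strictMono_iff_lt_succ.2 fun j => ?_
      fin_cases j
      · exact h
      · exact h'
    refine ⟨![a, b, c], hmono _ h1 h2, fun j k => ?_⟩
    exact (hmono (fun j => σ (![a, b, c] j)) h3 h4).lt_iff_lt

theorem isAvoider_graphPoints_iff {σ : Equiv.Perm (Fin n)} :
    IsAvoider (intRange n) (graphPoints σ) ↔ ¬ ContainsPattern pattern123 σ := by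
  rw [containsPattern_123_iff]
  constructor
  · rintro h ⟨a, b, c, h1, h2, h3, h4⟩
    exact h.2 (coe_mem_graphPoints.2 rfl) (coe_mem_graphPoints.2 rfl) (coe_mem_graphPoints.2 rfl)
      (by exact_mod_cast h1) (by exact_mod_cast h2) (by exact_mod_cast h3) (by exact_mod_cast h4)
  · refine fun h => ⟨isBijGraph_graphPoints σ, ?_⟩
    intro x₁ y₁ x₂ y₂ x₃ y₃ h1 h2 h3 a b c d
    obtain ⟨k, rfl, rfl⟩ := mem_graphPoints.1 h1
    obtain ⟨l, rfl, rfl⟩ := mem_graphPoints.1 h2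
    obtain ⟨m, rfl, rfl⟩ := mem_graphPoints.1 h3
    exact h ⟨k, l, m, by exact_mod_cast a, by exact_mod_cast b, by exact_mod_cast c,
      by exact_mod_cast d⟩

theorem exists_graphPoints_eq {S : Finset (ℤ × ℤ)}
    (h : IsBijGraph (intRange n) (intRange n) S) : ∃ σ : Equiv.Perm (Fin n), graphPoints σ = S := by
  have h1 : ∀ k : Fin n, ∃ l : Fin n, (((k : ℕ) : ℤ), ((l : ℕ) : ℤ)) ∈ S := by
    intro k
    obtain ⟨y, hy⟩ := h.exists_snd (coe_mem_intRange k)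
    obtain ⟨l, rfl⟩ := exists_fin_of_mem_intRange (h.snd_mem hy)
    exact ⟨l, hy⟩
  choose f hf using h1
  have hinj : Function.Injective f := by
    intro k l hkl
    have := hf l
    rw [← hkl] at this
    exact Fin.ext (by exact_mod_cast h.fst_unique (hf k) this)
  refine ⟨Equiv.ofBijective f (Finite.injective_iff_bijective.1 hinj), ?_⟩
  ext ⟨x, y⟩
  rw [mem_graphPoints]
  constructor
  · rintro ⟨k, rfl, rfl⟩
    exact hf k
  · intro hxy
    obtain ⟨k, rfl⟩ := exists_fin_of_mem_intRange (h.fst_mem hxy)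
    exact ⟨k, rfl, h.snd_unique (hf k) hxy⟩

theorem sum_avoiding_eq {M : Type*} [AddCommMonoid M] (f : Finset (ℤ × ℤ) → M) :
    ∑ σ : Avoiding n pattern123, f (graphPoints σ.1) = ∑ S ∈ avoiders (intRange n), f S := by
  refine Finset.sum_bij (fun σ _ => graphPoints σ.1) ?_ ?_ ?_ ?_
  · exact fun σ _ => mem_avoiders.2 (isAvoider_graphPoints_iff.2 σ.2)
  · exact fun σ _ τ _ h => Subtype.ext (graphPoints_injective h)
  · intro S hS
    rw [mem_avoiders] at hS
    obtain ⟨σ, rfl⟩ := exists_graphPoints_eq hS.1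
    exact ⟨⟨σ, isAvoider_graphPoints_iff.1 hS⟩, Finset.mem_univ _, rfl⟩
  · exact fun _ _ => rfl

theorem card_avoiding (n : ℕ) : Fintype.card (Avoiding n pattern123) = ballot (2 * n) 0 := by
  have h := sum_avoiding_eq (n := n) (fun _ => 1)
  simpa [card_avoiders, card_intRange] using h

/-- The indices of the points of `S` on the diagonal. -/
def fixedIndices (n : ℕ) (S : Finset (ℤ × ℤ)) : Finset ℕ :=
  (Finset.range n).filter fun i => ((i : ℤ), (i : ℤ)) ∈ S

theorem fp_eq_card_fixedIndices (σ : Equiv.Perm (Fin n)) :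
    fp σ = (fixedIndices n (graphPoints σ)).card := by
  refine Finset.card_bij (fun k _ => (k : ℕ)) ?_ ?_ ?_
  · intro k hk
    rw [Finset.mem_filter] at hk
    exact Finset.mem_filter.2 ⟨Finset.mem_range.2 k.2, coe_mem_graphPoints.2 hk.2⟩
  · exact fun k _ l _ h => Fin.ext h
  · intro i hi
    rw [fixedIndices, Finset.mem_filter, Finset.mem_range] at hi
    exact ⟨⟨i, hi.1⟩, Finset.mem_filter.2 ⟨Finset.mem_univ _,
      coe_mem_graphPoints (k := ⟨i, hi.1⟩) (l := ⟨i, hi.1⟩) |>.1 hi.2⟩, rfl⟩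

theorem fp_le_two {σ : Equiv.Perm (Fin n)} (h : ¬ ContainsPattern pattern123 σ) : fp σ ≤ 2 := by
  by_contra! hlt
  rw [containsPattern_123_iff] at h
  let e := (Finset.univ.filter fun i => σ i = i).orderEmbOfFin rfl
  have he : ∀ k, σ (e k) = e k := fun k =>
    (Finset.mem_filter.1 (Finset.orderEmbOfFin_mem (Finset.univ.filter fun i => σ i = i) rfl k)).2
  have h3 : 2 < (Finset.univ.filter fun i => σ i = i).card := hlt
  have h01 : e ⟨0, by omega⟩ < e ⟨1, by omega⟩ := e.strictMono (by simp)
  have h12 : e ⟨1, by omega⟩ < e ⟨2, by omega⟩ := e.strictMono (by simp)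
  exact h ⟨_, _, _, h01, h12, by rwa [he, he], by rwa [he, he]⟩

theorem card_filter_lt {W : Finset ℕ} (h : W.card ≤ 2) :
    ((W ×ˢ W).filter fun p => p.1 < p.2).card = if W.card = 2 then 1 else 0 := by
  split_ifs with h2
  · obtain ⟨a, b, hab, rfl⟩ := Finset.card_eq_two.1 h2
    rw [Finset.card_eq_one]
    rcases hab.lt_or_gt with hlt | hlt
    · refine ⟨(a, b), ?_⟩
      ext ⟨x, y⟩
      simp only [Finset.mem_filter, Finset.mem_product, Finset.mem_insert, Finset.mem_singleton,
        Prod.mk.injEq]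
      omega
    · refine ⟨(b, a), ?_⟩
      ext ⟨x, y⟩
      simp only [Finset.mem_filter, Finset.mem_product, Finset.mem_insert, Finset.mem_singleton,
        Prod.mk.injEq]
      omega
  · have h1 : W.card ≤ 1 := by omega
    rw [Finset.card_eq_zero]
    refine Finset.eq_empty_of_forall_notMem fun p hp => ?_
    rw [Finset.mem_filter, Finset.mem_product] at hp
    exact hp.2.ne (Finset.card_le_one.1 h1 _ hp.1.1 _ hp.1.2)

/-- The number of `123`-avoiding permutations of `n` letters with exactly `k` fixed points. -/
noncomputable def fixedCount (n k : ℕ) : ℕ :=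
  ((Finset.univ : Finset (Avoiding n pattern123)).filter fun σ => fp σ.1 = k).card

theorem sum_avoiding_fp {M : Type*} [AddCommMonoid M] (n : ℕ) (g : ℕ → M) :
    ∑ σ : Avoiding n pattern123, g (fp σ.1) = ∑ k ∈ Finset.range 3, fixedCount n k • g k := by
  rw [← Finset.sum_fiberwise_of_maps_to (t := Finset.range 3) (g := fun σ => fp σ.1)]
  · refine Finset.sum_congr rfl fun k _ => ?_
    rw [Finset.sum_congr rfl (g := fun _ => g k), Finset.sum_const, fixedCount]
    intro σ hσ
    rw [(Finset.mem_filter.1 hσ).2]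
  · intro σ _
    have := fp_le_two σ.2
    rw [Finset.mem_range]; omega

theorem sum_fixedCount (n : ℕ) :
    fixedCount n 0 + fixedCount n 1 + fixedCount n 2 = ballot (2 * n) 0 := by
  have h := sum_avoiding_fp n (fun _ => 1)
  rw [← card_avoiding]
  simpa [Finset.sum_range_succ] using h.symm

/-- Double counting of the pairs formed by an avoider and one of its fixed points. -/
theorem sum_mul_fixedCount (s : ℕ) :
    fixedCount (s + 1) 1 + 2 * fixedCount (s + 1) 2 + centralFixedCount (s + 1)
      = 2 * ballot (2 * s) 0 := by
  classical
  have h := sum_avoiding_fp (s + 1) (fun k => k)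
  simp only [fp_eq_card_fixedIndices] at h
  rw [sum_avoiding_eq (fun S => (fixedIndices (s + 1) S).card)] at h
  have h2 := Finset.sum_card_bipartiteAbove_eq_sum_card_bipartiteBelow
    (s := avoiders (intRange (s + 1))) (t := Finset.range (s + 1))
    (fun S (i : ℕ) => ((i : ℤ), (i : ℤ)) ∈ S)
  have h3 : ∑ S ∈ avoiders (intRange (s + 1)), (fixedIndices (s + 1) S).card
    = ∑ i ∈ Finset.range (s + 1), ((avoiders (intRange (s + 1))).filter fun S =>
      ((i : ℤ), (i : ℤ)) ∈ S).card := h2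
  rw [← sum_card_avoiders_fixed s, ← h3, h]
  simp [Finset.sum_range_succ]
  ring

/-- Since no avoider has three fixed points, an avoider has one increasing pair of fixed points if
it has two of them, and none otherwise. Counting avoiders together with such a pair therefore counts
each avoider with two fixed points once. -/
theorem fixedCount_two (N : ℕ) : (fixedCount (N + 2) 2 : ℤ) = ballotConvSum 0 N := by
  classical
  rw [← sum_card_avoiders_two_fixed]
  have h2 := Finset.sum_card_bipartiteAbove_eq_sum_card_bipartiteBelow
    (s := avoiders (intRange (N + 2)))
    (t := (Finset.range (N + 2) ×ˢ Finset.range (N + 2)).filter fun p => p.1 < p.2)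
    (fun S (p : ℕ × ℕ) => ((p.1 : ℤ), (p.1 : ℤ)) ∈ S ∧ ((p.2 : ℤ), (p.2 : ℤ)) ∈ S)
  have h3 : ∀ S ∈ avoiders (intRange (N + 2)),
      ((((Finset.range (N + 2) ×ˢ Finset.range (N + 2)).filter fun p => p.1 < p.2).filter
        fun p => ((p.1 : ℤ), (p.1 : ℤ)) ∈ S ∧ ((p.2 : ℤ), (p.2 : ℤ)) ∈ S)).card
      = if (fixedIndices (N + 2) S).card = 2 then 1 else 0 := by
    intro S hS
    rw [mem_avoiders] at hS
    obtain ⟨σ, rfl⟩ := exists_graphPoints_eq hS.1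
    have := fp_le_two (isAvoider_graphPoints_iff.1 hS)
    rw [fp_eq_card_fixedIndices] at this
    rw [← card_filter_lt this]
    congr 1
    ext p
    simp only [Finset.mem_filter, Finset.mem_product, fixedIndices]
    tauto
  have h4 := Finset.sum_congr rfl h3
  rw [← sum_avoiding_eq (fun S => if (fixedIndices (N + 2) S).card = 2 then 1 else 0)] at h4
  simp only [← fp_eq_card_fixedIndices] at h4
  congr 1
  rw [fixedCount, Finset.card_filter, ← h4]
  exact h2

end Graph

/-! ### Limits of the proportions. -/

section Limits

open scoped Topology

theorem ballot_two_mul_pos (n : ℕ) : (0 : ℝ) < ballot (2 * n) 0 := by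
  have h := succ_mul_ballot_two_mul n
  have h2 := Nat.centralBinom_pos n
  rw [← h] at h2
  exact_mod_cast Nat.pos_of_mul_pos_left h2

theorem ballot_two_mul_succ (n : ℕ) :
    ((n : ℝ) + 2) * ballot (2 * (n + 1)) 0 = 2 * (2 * n + 1) * ballot (2 * n) 0 := by
  have h1 := succ_mul_ballot_two_mul n
  have h2 := succ_mul_ballot_two_mul (n + 1)
  have h3 := Nat.succ_mul_centralBinom_succ n
  rw [← h1, ← h2] at h3
  have h4 : ((n : ℝ) + 1) * (((n : ℝ) + 1 + 1) * ballot (2 * (n + 1)) 0)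
      = 2 * (2 * n + 1) * (((n : ℝ) + 1) * ballot (2 * n) 0) := by exact_mod_cast h3
  have h5 : ((n : ℝ) + 1) ≠ 0 := by positivity
  apply mul_left_cancel₀ h5
  linear_combination h4

/-- An elementary lower bound for the central binomial coefficient. The induction step reduces to
4(n + 1)²(4n + 1) ≤ (2n + 1)²(4n + 5), where the two sides differ by 1. -/
theorem sixteen_pow_le (n : ℕ) : 16 ^ n ≤ (4 * n + 1) * n.centralBinom ^ 2 := by
  induction n with
  | zero => simp
  | succ n ih =>
    have h3 := Nat.succ_mul_centralBinom_succ n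
    have h4 : (n + 1) ^ 2 * 16 ^ (n + 1)
        ≤ (n + 1) ^ 2 * ((4 * (n + 1) + 1) * (n + 1).centralBinom ^ 2) := by
      calc (n + 1) ^ 2 * 16 ^ (n + 1) = 16 * (n + 1) ^ 2 * 16 ^ n := by ring
        _ ≤ 16 * (n + 1) ^ 2 * ((4 * n + 1) * n.centralBinom ^ 2) := by gcongr
        _ = 4 * (4 * (n + 1) ^ 2 * (4 * n + 1)) * n.centralBinom ^ 2 := by ring
        _ ≤ 4 * ((2 * n + 1) ^ 2 * (4 * n + 5)) * n.centralBinom ^ 2 := by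
          gcongr ?_ * _
          nlinarith
        _ = (4 * (n + 1) + 1) * (2 * (2 * n + 1) * n.centralBinom) ^ 2 := by ring
        _ = (4 * (n + 1) + 1) * ((n + 1) * (n + 1).centralBinom) ^ 2 := by rw [h3]
        _ = _ := by ring
    exact Nat.le_of_mul_le_mul_left h4 (by positivity)

theorem tendsto_ballot_ratio :
    Tendsto (fun n : ℕ => (ballot (2 * n) 0 : ℝ) / ballot (2 * (n + 1)) 0) atTop (𝓝 (1 / 4)) := by
  have h : ∀ n : ℕ, (ballot (2 * n) 0 : ℝ) / ballot (2 * (n + 1)) 0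
      = 1 / 4 + (3 / 8) / ((n : ℝ) + 1 / 2) := by
    intro n
    have h1 := ballot_two_mul_pos (n + 1)
    have h2 := ballot_two_mul_succ n
    rw [div_eq_iff h1.ne']
    field_simp
    linear_combination (-16 : ℝ) * h2
  simp only [h]
  have : Tendsto (fun n : ℕ => (n : ℝ) + 1 / 2) atTop atTop :=
    tendsto_atTop_add_const_right _ _ tendsto_natCast_atTop_atTop
  simpa using (tendsto_const_nhds (x := (1 / 4 : ℝ))).add (this.const_div_atTop (3 / 8))

/-- Catalan numbers are at least of order 4ⁿ/n^(3/2), so every error of order 4ⁿ/n² is negligible.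
-/
theorem tendsto_four_pow_div :
    Tendsto (fun n : ℕ => (4 : ℝ) ^ n / (n + 3) ^ 2 / ballot (2 * n) 0) atTop (𝓝 0) := by
  have hb : ∀ n : ℕ, (4 : ℝ) ^ n / (n + 3) ^ 2 / ballot (2 * n) 0 ≤ 2 / √((n : ℝ) + 1) := by
    intro n
    have h0 := ballot_two_mul_pos n
    have h1 : (16 : ℝ) ^ n ≤ (4 * n + 1) * (n.centralBinom : ℝ) ^ 2 := by
      exact_mod_cast sixteen_pow_le n
    have h2 : ((n : ℝ) + 1) * ballot (2 * n) 0 = n.centralBinom := by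
      exact_mod_cast succ_mul_ballot_two_mul n
    have hs : √((n : ℝ) + 1) ^ 2 = n + 1 := Real.sq_sqrt (by positivity)
    have hs0 : 0 < √((n : ℝ) + 1) := Real.sqrt_pos.2 (by positivity)
    have h3 : (4 : ℝ) ^ n ≤ 2 * √((n : ℝ) + 1) * (((n : ℝ) + 1) * ballot (2 * n) 0) := by
      refine le_of_sq_le_sq ?_ (by positivity)
      rw [mul_pow, mul_pow, hs, h2, ← pow_mul, mul_comm n 2, pow_mul]
      norm_num
      nlinarith [sq_nonneg (n.centralBinom : ℝ)]
    rw [div_div, div_le_div_iff₀ (by positivity) hs0]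
    have h4 : ((n : ℝ) + 1) ^ 2 ≤ (n + 3) ^ 2 := by gcongr; norm_num
    calc (4 : ℝ) ^ n * √((n : ℝ) + 1)
        ≤ 2 * √((n : ℝ) + 1) * (((n : ℝ) + 1) * ballot (2 * n) 0) * √((n : ℝ) + 1) := by gcongr
      _ = 2 * (√((n : ℝ) + 1) ^ 2 * (n + 1) * ballot (2 * n) 0) := by ring
      _ = 2 * (((n : ℝ) + 1) ^ 2 * ballot (2 * n) 0) := by rw [hs]; ring
      _ ≤ 2 * ((n + 3) ^ 2 * ballot (2 * n) 0) := by gcongr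
  have h1 : Tendsto (fun n : ℕ => 2 / √((n : ℝ) + 1)) atTop (𝓝 0) := by
    refine Tendsto.const_div_atTop ?_ _
    exact Real.tendsto_sqrt_atTop.comp
      (tendsto_atTop_add_const_right _ _ tendsto_natCast_atTop_atTop)
  exact squeeze_zero (fun n => by positivity) hb h1

theorem tendsto_ballotConvSum :
    Tendsto (fun n : ℕ => (ballotConvSum 0 n : ℝ) / ballot (2 * n) 0) atTop (𝓝 1) := by
  have h : Tendsto (fun n : ℕ => (ballotConvSum 0 n : ℝ) / ballot (2 * n) 0 - 1) atTop (𝓝 0) := by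
    refine squeeze_zero_norm (fun n => ?_)
      (by simpa using tendsto_four_pow_div.const_mul 648)
    have h0 := ballot_two_mul_pos n
    have h1 := abs_ballotConvSum_sub_le n 0
    rw [ballotSqTail_zero, Int.cast_natCast] at h1
    rw [Real.norm_eq_abs, div_sub_one h0.ne', abs_div, abs_of_pos h0, ← mul_div_assoc]
    gcongr
  simpa using h.add_const 1

theorem tendsto_fixedCount_two :
    Tendsto (fun n : ℕ => (fixedCount n 2 : ℝ) / ballot (2 * n) 0) atTop (𝓝 (1 / 16)) := by
  rw [← tendsto_add_atTop_iff_nat 2]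
  -- The quotient telescopes as (D_0(n) / C_n) · (C_n / C_{n+1}) · (C_{n+1} / C_{n+2}), with limit 1
  -- · 1/4 · 1/4.
  have h1 := (tendsto_ballotConvSum.mul tendsto_ballot_ratio).mul
    ((tendsto_add_atTop_iff_nat 1).2 tendsto_ballot_ratio)
  refine (h1.congr fun n => ?_).trans (by norm_num)
  have e0 := (ballot_two_mul_pos n).ne'
  have e1 := (ballot_two_mul_pos (n + 1)).ne'
  have e2 : (fixedCount (n + 2) 2 : ℝ) = ballotConvSum 0 n := by
    exact_mod_cast fixedCount_two n
  rw [e2, div_mul_div_cancel₀ e0, div_mul_div_cancel₀ e1]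

theorem tendsto_centralFixedCount :
    Tendsto (fun n : ℕ => (centralFixedCount (n + 1) : ℝ) / ballot (2 * (n + 1)) 0) atTop
      (𝓝 0) := by
  have h1 := (tendsto_four_pow_div.mul tendsto_ballot_ratio).const_mul 144
  rw [zero_mul, mul_zero] at h1
  refine squeeze_zero (fun n => by positivity) (fun n => ?_) h1
  have e0 := (ballot_two_mul_pos n).ne'
  have e1 := ballot_two_mul_pos (n + 1)
  rw [div_mul_div_cancel₀ e0, ← mul_div_assoc]
  gcongr
  exact le_trans (by exact_mod_cast centralFixedCount_le n) (ballot_sq_le n 0)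

theorem tendsto_fixedCount_one :
    Tendsto (fun n : ℕ => (fixedCount n 1 : ℝ) / ballot (2 * n) 0) atTop (𝓝 (6 / 16)) := by
  rw [← tendsto_add_atTop_iff_nat 1]
  have h1 := ((tendsto_ballot_ratio.const_mul 2).sub
    (((tendsto_add_atTop_iff_nat 1).2 tendsto_fixedCount_two).const_mul 2)).sub
    tendsto_centralFixedCount
  refine (h1.congr fun n => ?_).trans (by norm_num)
  have e1 := (ballot_two_mul_pos (n + 1)).ne'
  have e2 : (fixedCount (n + 1) 1 : ℝ) + 2 * fixedCount (n + 1) 2 + centralFixedCount (n + 1)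
      = 2 * ballot (2 * n) 0 := by exact_mod_cast sum_mul_fixedCount n
  field_simp
  linear_combination -e2

theorem tendsto_fixedCount_zero :
    Tendsto (fun n : ℕ => (fixedCount n 0 : ℝ) / ballot (2 * n) 0) atTop (𝓝 (9 / 16)) := by
  have h1 := ((tendsto_const_nhds (x := (1 : ℝ))).sub tendsto_fixedCount_one).sub
    tendsto_fixedCount_two
  refine (h1.congr fun n => ?_).trans (by norm_num)
  have e1 := (ballot_two_mul_pos n).ne'
  have e2 : (fixedCount n 0 : ℝ) + fixedCount n 1 + fixedCount n 2 = ballot (2 * n) 0 := by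
    exact_mod_cast sum_fixedCount n
  field_simp
  linear_combination -e2

theorem tendsto_weighted_fixedCount (g : ℕ → ℝ) :
    Tendsto (fun n : ℕ => (∑ σ : Avoiding n pattern123, g (fp σ.1)) / ballot (2 * n) 0) atTop
      (𝓝 ((9 * g 0 + 6 * g 1 + g 2) / 16)) := by
  have h1 := ((tendsto_fixedCount_zero.mul_const (g 0)).add
    (tendsto_fixedCount_one.mul_const (g 1))).add (tendsto_fixedCount_two.mul_const (g 2))
  refine (h1.congr fun n => ?_).trans (by ring_nf; exact le_rfl)
  rw [sum_avoiding_fp]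
  simp only [Finset.sum_range_succ, Finset.sum_range_zero, nsmul_eq_mul, zero_add]
  ring

end Limits

/-! ### Convergence in distribution. -/

instance Avoiding.instMeasurableSingletonClass (n : ℕ) {m : ℕ} (τ : Equiv.Perm (Fin m)) :
    MeasurableSingletonClass (Avoiding n τ) := ⟨fun _ => trivial⟩

theorem integral_biasedMeasure {q : ℝ} (hq : 0 < q) (n : ℕ) (g : ℕ → ℝ) :
    ∫ σ, g (fp σ.1) ∂(biasedMeasure q n pattern123) =
      (∑ σ : Avoiding n pattern123, q ^ fp σ.1 * g (fp σ.1)) / normConst q n pattern123 := by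
  have hZ : 0 ≤ normConst q n pattern123 := Finset.sum_nonneg fun σ _ => (pow_pos hq _).le
  rw [biasedMeasure, integral_finsetSum_measure]
  · rw [Finset.sum_div]
    refine Finset.sum_congr rfl fun σ _ => ?_
    rw [integral_smul_measure, integral_dirac,
      ENNReal.toReal_ofReal (div_nonneg (pow_pos hq _).le hZ), smul_eq_mul]
    ring
  · intro σ _
    exact (integrable_dirac (by simp)).smul_measure ENNReal.ofReal_ne_top

theorem integral_bernoulli_add {q : ℝ} (hq : 0 < q)
    {Ω : Type*} [MeasurableSpace Ω] (μ : Measure Ω) [IsProbabilityMeasure μ] (A B : Ω → ℝ)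
    (hA : HasLaw A (bernoulliMeasure (1 : ℝ) 0 ⟨q / (3 + q), bernoulliParam_mem hq⟩) μ)
    (hB : HasLaw B (bernoulliMeasure (1 : ℝ) 0 ⟨q / (3 + q), bernoulliParam_mem hq⟩) μ)
    (hAB : IndepFun A B μ) (f : BoundedContinuousFunction ℝ ℝ) :
    ∫ x, f x ∂(μ.map fun ω => A ω + B ω) =
      (9 * f 0 + 6 * q * f 1 + q ^ 2 * f 2) / (3 + q) ^ 2 := by
  have hm : μ.map (fun ω => A ω + B ω) = ((μ.map A).prod (μ.map B)).map (fun p => p.1 + p.2) := by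
    rw [← (indepFun_iff_map_prod_eq_prod_map_map hA.aemeasurable hB.aemeasurable).1 hAB,
      AEMeasurable.map_map_of_aemeasurable (by fun_prop)
        (hA.aemeasurable.prodMk hB.aemeasurable)]
    rfl
  rw [hm, hA.map_eq, hB.map_eq, integral_map (by fun_prop) (by fun_prop), integral_prod]
  · simp only [integral_bernoulliMeasure, smul_eq_mul, add_zero, zero_add]
    have h3 : (3 + q) ≠ 0 := by positivity
    rw [one_add_one_eq_two]
    field_simp
    ring
  · exact (f.compContinuous ⟨fun p : ℝ × ℝ => p.1 + p.2, by fun_prop⟩).integrable _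

theorem theorem2 (q : ℝ) (hq : 0 < q)
    {Ω : Type*} [MeasurableSpace Ω] (μ : Measure Ω) [IsProbabilityMeasure μ] (A B : Ω → ℝ)
    (hA : HasLaw A (bernoulliMeasure (1 : ℝ) 0 ⟨q / (3 + q), bernoulliParam_mem hq⟩) μ)
    (hB : HasLaw B (bernoulliMeasure (1 : ℝ) 0 ⟨q / (3 + q), bernoulliParam_mem hq⟩) μ)
    (hAB : IndepFun A B μ) :
    TendstoInDistribution
      (fun (n : ℕ) (σ : Avoiding n pattern123) => (fp σ.1 : ℝ)) atTop
      (fun ω => A ω + B ω)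
      (fun n => (biasedProb q hq n pattern123 : Measure (Avoiding n pattern123))) μ := by
  have hmeas : ∀ n, Measurable fun σ : Avoiding n pattern123 => (fp σ.1 : ℝ) :=
    fun n => measurable_from_top
  refine ⟨fun n => (hmeas n).aemeasurable, hA.aemeasurable.add hB.aemeasurable, ?_⟩
  refine ProbabilityMeasure.tendsto_iff_forall_integral_tendsto.2 fun f => ?_
  -- The expectation of f is a quotient of two weighted sums, the weighted sum of f and the
  -- normalization constant. Each is divided by the Catalan number, which cancels in the quotient.
  have h1 := tendsto_weighted_fixedCount fun k => q ^ k * f k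
  have h2 := tendsto_weighted_fixedCount fun k => q ^ k
  have h3 := h1.div h2 (by positivity)
  have hlim : (9 * (q ^ 0 * f (0 : ℕ)) + 6 * (q ^ 1 * f (1 : ℕ)) + q ^ 2 * f (2 : ℕ)) / 16
      / ((9 * q ^ 0 + 6 * q ^ 1 + q ^ 2) / 16)
      = ∫ x, f x ∂(μ.map fun ω => A ω + B ω) := by
    rw [integral_bernoulli_add hq μ A B hA hB hAB f]
    have h4 : (9 * q ^ 0 + 6 * q ^ 1 + q ^ 2) = (3 + q) ^ 2 := by ring
    rw [h4]
    push_cast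
    field_simp
  rw [hlim] at h3
  refine h3.congr fun n => ?_
  have e1 := (ballot_two_mul_pos n).ne'
  have e2 : ∫ x, f x ∂((biasedMeasure q n pattern123).map
      fun σ : Avoiding n pattern123 => (fp σ.1 : ℝ))
      = (∑ σ : Avoiding n pattern123, q ^ fp σ.1 * f (fp σ.1)) / normConst q n pattern123 := by
    rw [integral_map (hmeas n).aemeasurable f.continuous.aestronglyMeasurable]
    exact integral_biasedMeasure hq n fun k => f k
  refine Eq.trans ?_ e2.symm
  simp only [Pi.div_apply]
  rw [div_div_div_cancel_right₀ e1]
  rfl
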